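/- Let $A$ be a unital Banach $\mathbb{R}$-algebra, $G$ a compact Lie group, and $X$ a compact Hausdorff space with a continuous action of $G$. Let $\mathcal{A}$ be a locally trivial bundle of Banach algebras on $X$ with fibre $A$ (its structure group being the group of continuous algebra automorphisms of $A$ with the strong topology), on which $G$ acts continuously, each $g\in G$ acting by algebra isomorphisms $\mathcal{A}_x\to\mathcal{A}_{gx}$. A $G$–$\mathcal{A}$ bundle is a locally trivial bundle $E$ of left $\mathcal{A}$-modules such that $\mathcal{A}\times_X E\to E$ is continuous and every fibre $E_x$ is a finitely generated projective $\mathcal{A}_x$-module, together with a continuous $G$-action, additive maps $E_x\to E_{gx}$, satisfying $g(a\cdot e)=g(a)\cdot g(e)$ for $g\in G$, $a\in\mathcal{A}_x$, $e\in E_x$. Morphisms are the $G$-equivariant continuous bundle maps that are $\mathcal{A}_x$-linear on fibres, and $K_G^{\mathcal{A}}(X)$ denotes the Grothendieck group of the additive category of $G$–$\mathcal{A}$ bundles on $X$. Let $I=[0,1]$, let $G$ act on $X\times I$ by $g(x,t)=(gx,t)$, let $p:X\times I\to X$ be the projection, and write $\mathcal{A}$ also for the pullback $p^*\mathcal{A}$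 on $X\times I$. Then the homomorphism $[E]\mapsto[p^*E]$ is an isomorphism $$p^*: K_G^{\mathcal{A}}(X)\;\xrightarrow{\ \cong\ }\;K_G^{\mathcal{A}}(X\times I).$$ -/

import Mathlib

open Bundle

universe u u' v w

noncomputable section

namespace TwistedK

section Bundles

/-- The total space of a family of types over `X`. It carries no default topology; each bundle
below comes with its own. -/
abbrev Tot {X : Type u} (E : X → Type v) : Type (max u v) := TotalSpace PUnit.{1} E

/-- A family of bijections `ψ y : E y ≃ F`, for `y ∈ U`, is a local trivialization over `U` if the
induced bijection `π⁻¹(U) → U × F`, `e ↦ (π e, ψ e)`, is a homeomorphism. (The projection `π` is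
required to be continuous in the definitions of bundles below, so that only the second component
and the inverse have to be considered.) -/
def IsLocalTriv {X : Type u} [TopologicalSpace X] {E : X → Type v} [TopologicalSpace (Tot E)]
    {F : Type v} [TopologicalSpace F] (U : Set X) (ψ : ∀ y : U, E y ≃ F) : Prop :=
  Continuous (fun p : {p : Tot E // p.proj ∈ U} => ψ ⟨p.1.proj, p.2⟩ p.1.snd) ∧
  Continuous (fun q : U × F => (⟨q.1, (ψ q.1).symm q.2⟩ : Tot E))

/-- A locally trivial bundle `𝒜` of Banach algebras on the `G`-space `X`, with fibre the Banach
algebra `A`, on which `G` acts by algebra isomorphisms covering the action on `X`.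

Being jointly continuous in the point and the vector, the local trivializations have transition
functions in the group of continuous algebra automorphisms of `A`, continuous for the strong
topology.

The action is a family of maps `act g h : 𝒜_x → 𝒜_x'`, one for each proof `h : g • x = x'`. By
`act_one` and `act_mul` these homomorphisms are isomorphisms, with inverse `act g⁻¹ _`. -/
structure GAlgBundle (G : Type w) (X : Type u) (A : Type v) [Group G] [TopologicalSpace G]
    [TopologicalSpace X] [MulAction G X] [NormedRing A] [NormedAlgebra ℝ A] where
  Fib : X → Type v
  [ring : ∀ x, Ring (Fib x)]
  [algebra : ∀ x, Algebra ℝ (Fib x)]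
  [top : TopologicalSpace (Tot Fib)]
  continuous_proj : Continuous (TotalSpace.proj : Tot Fib → X)
  exists_chart : ∀ x : X, ∃ U : Set X, IsOpen U ∧ x ∈ U ∧
    ∃ φ : ∀ y : U, Fib y ≃ₐ[ℝ] A, IsLocalTriv U (fun y => (φ y).toEquiv)
  act : ∀ (g : G) {x x' : X}, g • x = x' → (Fib x →ₐ[ℝ] Fib x')
  act_one : ∀ {x : X} (h : (1 : G) • x = x) (a : Fib x), act 1 h a = a
  act_mul : ∀ (g₁ g₂ : G) {x x' x'' : X} (h₂ : g₂ • x = x') (h₁ : g₁ • x' = x'')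
    (h : (g₁ * g₂) • x = x'') (a : Fib x), act (g₁ * g₂) h a = act g₁ h₁ (act g₂ h₂ a)
  continuous_act : Continuous fun q : G × Tot Fib =>
    (⟨q.1 • q.2.proj, act q.1 rfl q.2.snd⟩ : Tot Fib)

attribute [instance] GAlgBundle.ring GAlgBundle.algebra GAlgBundle.top

variable {G : Type w} {X : Type u} {A : Type v} [Group G] [TopologicalSpace G]
  [TopologicalSpace X] [MulAction G X] [NormedRing A] [NormedAlgebra ℝ A]

/-- A `G`-`𝒜` bundle on `X`: a locally trivial bundle `E` of left `𝒜`-modules whose fibres are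
finitely generated projective, with an action of `G` such that `g (a • e) = g a • g e`.

Local triviality: near each point there are a trivialization `φ` of the algebra bundle, a finitely
generated projective `A`-module `P` with its canonical topology (as a quotient, or as a direct
summand, of some `A ^ n`), and a compatible trivialization `ψ` of `E` with fibre `P`. -/
structure GABundle (𝒜 : GAlgBundle G X A) where
  Fib : X → Type v
  [addCommGroup : ∀ x, AddCommGroup (Fib x)]
  [module : ∀ x, Module (𝒜.Fib x) (Fib x)]
  [top : TopologicalSpace (Tot Fib)]
  continuous_proj : Continuous (TotalSpace.proj : Tot Fib → X)
  continuous_smul : Continuous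
    fun p : {p : Tot 𝒜.Fib × Tot Fib // p.1.proj = p.2.proj} =>
      (⟨p.1.2.proj, (cast (congrArg 𝒜.Fib p.2) p.1.1.snd : 𝒜.Fib p.1.2.proj) • p.1.2.snd⟩ :
        Tot Fib)
  exists_chart : ∀ x : X, ∃ U : Set X, IsOpen U ∧ x ∈ U ∧
    ∃ φ : ∀ y : U, 𝒜.Fib y ≃ₐ[ℝ] A, IsLocalTriv U (fun y => (φ y).toEquiv) ∧
    ∃ (P : Type v) (_ : AddCommGroup P) (_ : Module A P) (_ : TopologicalSpace P),
      Module.Finite A P ∧ Module.Projective A P ∧ IsModuleTopology A P ∧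
      ∃ ψ : ∀ y : U, Fib y ≃+ P, IsLocalTriv U (fun y => (ψ y).toEquiv) ∧
        ∀ (y : U) (a : 𝒜.Fib y) (e : Fib y), ψ y (a • e) = φ y a • ψ y e
  act : ∀ (g : G) {x x' : X}, g • x = x' → (Fib x →+ Fib x')
  act_one : ∀ {x : X} (h : (1 : G) • x = x) (e : Fib x), act 1 h e = e
  act_mul : ∀ (g₁ g₂ : G) {x x' x'' : X} (h₂ : g₂ • x = x') (h₁ : g₁ • x' = x'')
    (h : (g₁ * g₂) • x = x'') (e : Fib x), act (g₁ * g₂) h e = act g₁ h₁ (act g₂ h₂ e)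
  continuous_act : Continuous fun q : G × Tot Fib =>
    (⟨q.1 • q.2.proj, act q.1 rfl q.2.snd⟩ : Tot Fib)
  act_smul : ∀ (g : G) {x x' : X} (h : g • x = x') (a : 𝒜.Fib x) (e : Fib x),
    act g h (a • e) = 𝒜.act g h a • act g h e

attribute [instance] GABundle.addCommGroup GABundle.module GABundle.top

/-- Morphisms of `G`-`𝒜` bundles: equivariant bundle maps which are `𝒜_x`-linear on fibres. -/
structure GABundle.Hom {𝒜 : GAlgBundle G X A} (E F : GABundle 𝒜) where
  map : ∀ x : X, E.Fib x →ₗ[𝒜.Fib x] F.Fib x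
  continuous_map : Continuous fun p : Tot E.Fib => (⟨p.proj, map p.proj p.snd⟩ : Tot F.Fib)
  map_act : ∀ (g : G) {x x' : X} (h : g • x = x') (e : E.Fib x),
    map x' (E.act g h e) = F.act g h (map x e)

/-- `E` is a direct sum of `E₁` and `E₂` in the additive category of `G`-`𝒜` bundles: there is a
biproduct diagram of morphisms. -/
def GABundle.IsDirectSum {𝒜 : GAlgBundle G X A} (E E₁ E₂ : GABundle 𝒜) : Prop :=
  ∃ (i₁ : E₁.Hom E) (i₂ : E₂.Hom E) (p₁ : E.Hom E₁) (p₂ : E.Hom E₂), ∀ x : X,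
    p₁.map x ∘ₗ i₁.map x = LinearMap.id ∧ p₂.map x ∘ₗ i₂.map x = LinearMap.id ∧
    p₁.map x ∘ₗ i₂.map x = 0 ∧ p₂.map x ∘ₗ i₁.map x = 0 ∧
    i₁.map x ∘ₗ p₁.map x + i₂.map x ∘ₗ p₂.map x = LinearMap.id

/-- The relations `[E] = [E₁] + [E₂]`, one for each direct sum decomposition `E ≅ E₁ ⊕ E₂`.
(With `E₂ = 0` they identify isomorphic bundles.) -/
def KRelations (𝒜 : GAlgBundle G X A) : AddSubgroup (FreeAbelianGroup (GABundle 𝒜)) :=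
  AddSubgroup.closure {r | ∃ E E₁ E₂ : GABundle 𝒜, E.IsDirectSum E₁ E₂ ∧
    r = FreeAbelianGroup.of E - (FreeAbelianGroup.of E₁ + FreeAbelianGroup.of E₂)}

/-- `K_G^𝒜(X)`: the Grothendieck group of the additive category of `G`-`𝒜` bundles on `X`. -/
abbrev KGroup (𝒜 : GAlgBundle G X A) : Type (max u (v + 1) w) :=
  FreeAbelianGroup (GABundle 𝒜) ⧸ KRelations 𝒜

/-- The class of a `G`-`𝒜` bundle in `K_G^𝒜(X)`. -/
def KGroup.mk {𝒜 : GAlgBundle G X A} (E : GABundle 𝒜) : KGroup 𝒜 :=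
  QuotientAddGroup.mk (FreeAbelianGroup.of E)

theorem GAlgBundle.mk_act (𝒜 : GAlgBundle G X A) (g : G) {x x' : X} (h : g • x = x')
    (a : 𝒜.Fib x) : (⟨x', 𝒜.act g h a⟩ : Tot 𝒜.Fib) = ⟨g • x, 𝒜.act g rfl a⟩ := by
  subst h; rfl

theorem GABundle.mk_act {𝒜 : GAlgBundle G X A} (E : GABundle 𝒜) (g : G) {x x' : X}
    (h : g • x = x') (e : E.Fib x) :
    (⟨x', E.act g h e⟩ : Tot E.Fib) = ⟨g • x, E.act g rfl e⟩ := by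
  subst h; rfl

end Bundles

section Pullback

variable {X : Type u} {Y : Type u'} [TopologicalSpace Y]

/-- The inclusion of the total space of `f^*E` into `Y × E`. -/
def pullbackEmb (f : Y → X) (E : X → Type v) (z : Tot fun y => E (f y)) : Y × Tot E :=
  (z.proj, ⟨f z.proj, z.snd⟩)

/-- The topology of the pullback `f^*E`, as a subspace of `Y × E`. -/
abbrev pullbackTop (f : Y → X) (E : X → Type v) [TopologicalSpace (Tot E)] :
    TopologicalSpace (Tot fun y => E (f y)) :=
  TopologicalSpace.induced (pullbackEmb f E) inferInstance

theorem continuous_pullback_proj (f : Y → X) (E : X → Type v) [TopologicalSpace (Tot E)] :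
    letI := pullbackTop f E
    Continuous (TotalSpace.proj : Tot (fun y => E (f y)) → Y) :=
  letI := pullbackTop f E
  continuous_fst.comp (continuous_induced_dom (f := pullbackEmb f E))

theorem continuous_pullback_lift (f : Y → X) (E : X → Type v) [TopologicalSpace (Tot E)] :
    letI := pullbackTop f E
    Continuous (fun z : Tot (fun y => E (f y)) => (⟨f z.proj, z.snd⟩ : Tot E)) :=
  letI := pullbackTop f E
  continuous_snd.comp (continuous_induced_dom (f := pullbackEmb f E))

theorem continuous_into_pullback (f : Y → X) (E : X → Type v) [TopologicalSpace (Tot E)]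
    {Z : Type*} [TopologicalSpace Z] {k : Z → Tot (fun y => E (f y))}
    (h₁ : Continuous fun z => (k z).proj)
    (h₂ : Continuous fun z => (⟨f (k z).proj, (k z).snd⟩ : Tot E)) :
    letI := pullbackTop f E
    Continuous k :=
  continuous_induced_rng.2 (h₁.prodMk h₂)

theorem IsLocalTriv.pullback [TopologicalSpace X] {f : Y → X} (hf : Continuous f) {E : X → Type v}
    [TopologicalSpace (Tot E)] {F : Type v} [TopologicalSpace F] {U : Set X}
    {ψ : ∀ y : U, E y ≃ F} (h : IsLocalTriv U ψ) :
    letI := pullbackTop f E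
    IsLocalTriv (E := fun y => E (f y)) (f ⁻¹' U) (fun y => ψ ⟨f y.1, y.2⟩) := by
  let _ := pullbackTop f E
  refine ⟨?_, ?_⟩
  · exact h.1.comp (Continuous.subtype_mk
      ((continuous_pullback_lift f E).comp continuous_subtype_val) (fun p => p.2))
  · refine continuous_into_pullback f E (by fun_prop) ?_
    have : Continuous (fun q : (f ⁻¹' U) × F => ((⟨f q.1.1, q.1.2⟩ : U), q.2)) := by fun_prop
    exact h.2.comp this

variable {G : Type w} {A : Type v} [Group G] [TopologicalSpace G] [TopologicalSpace X]
  [MulAction G X] [MulAction G Y] [ContinuousSMul G Y] [NormedRing A] [NormedAlgebra ℝ A]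

/-- The pullback `f^*𝒜` of an algebra bundle along an equivariant continuous map. -/
def GAlgBundle.pullback (𝒜 : GAlgBundle G X A) (f : Y →[G] X) (hf : Continuous f) :
    GAlgBundle G Y A where
  Fib := fun y => 𝒜.Fib (f y)
  ring := fun y => 𝒜.ring (f y)
  algebra := fun y => 𝒜.algebra (f y)
  top := pullbackTop f 𝒜.Fib
  continuous_proj := continuous_pullback_proj f 𝒜.Fib
  exists_chart := fun y => by
    obtain ⟨U, hU, hy, φ, hφ⟩ := 𝒜.exists_chart (f y)
    exact ⟨f ⁻¹' U, hU.preimage hf, hy, fun y => φ ⟨f y.1, y.2⟩, hφ.pullback hf⟩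
  act := fun g _ _ h => 𝒜.act g (by rw [← h, map_smul])
  act_one := fun _ a => 𝒜.act_one _ a
  act_mul := fun g₁ g₂ _ _ _ _ _ _ a => 𝒜.act_mul g₁ g₂ _ _ _ a
  continuous_act := by
    let _ := pullbackTop f 𝒜.Fib
    refine continuous_into_pullback f 𝒜.Fib ?_ ?_
    · exact continuous_fst.smul ((continuous_pullback_proj f 𝒜.Fib).comp continuous_snd)
    · refine (𝒜.continuous_act.comp (continuous_fst.prodMk
        ((continuous_pullback_lift f 𝒜.Fib).comp continuous_snd))).congr ?_
      exact fun q => (𝒜.mk_act q.1 _ q.2.snd).symm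

/-- The pullback `f^*E`, a bundle of `f^*𝒜`-modules. -/
def GABundle.pullback {𝒜 : GAlgBundle G X A} (E : GABundle 𝒜) (f : Y →[G] X)
    (hf : Continuous f) : GABundle (𝒜.pullback f hf) where
  Fib := fun y => E.Fib (f y)
  addCommGroup := fun y => E.addCommGroup (f y)
  module := fun y => E.module (f y)
  top := pullbackTop f E.Fib
  continuous_proj := continuous_pullback_proj f E.Fib
  continuous_smul := by
    let _ := pullbackTop f 𝒜.Fib
    let _ := pullbackTop f E.Fib
    refine continuous_into_pullback f E.Fib ?_ ?_
    · have h := (continuous_pullback_proj f E.Fib).comp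
        (continuous_snd.comp (continuous_subtype_val (p := fun p :
          (Tot fun y => 𝒜.Fib (f y)) × (Tot fun y => E.Fib (f y)) => p.1.proj = p.2.proj)))
      exact h
    · have h₁ := (continuous_pullback_lift f 𝒜.Fib).comp
        (continuous_fst.comp (continuous_subtype_val (p := fun p :
          (Tot fun y => 𝒜.Fib (f y)) × (Tot fun y => E.Fib (f y)) => p.1.proj = p.2.proj)))
      have h₂ := (continuous_pullback_lift f E.Fib).comp
        (continuous_snd.comp (continuous_subtype_val (p := fun p :
          (Tot fun y => 𝒜.Fib (f y)) × (Tot fun y => E.Fib (f y)) => p.1.proj = p.2.proj)))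
      refine (E.continuous_smul.comp (Continuous.subtype_mk (h₁.prodMk h₂)
        (fun p => congrArg f p.2))).congr ?_
      rintro ⟨⟨⟨y, a⟩, ⟨y', e⟩⟩, h⟩
      obtain rfl : y = y' := h
      rfl
  exists_chart := fun y => by
    obtain ⟨U, hU, hy, φ, hφ, P, i₁, i₂, i₃, h₁, h₂, h₃, ψ, hψ, hs⟩ := E.exists_chart (f y)
    exact ⟨f ⁻¹' U, hU.preimage hf, hy, fun y => φ ⟨f y.1, y.2⟩, hφ.pullback hf, P, i₁, i₂, i₃,
      h₁, h₂, h₃, fun y => ψ ⟨f y.1, y.2⟩, hψ.pullback hf, fun y a e => hs ⟨f y.1, y.2⟩ a e⟩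
  act := fun g _ _ h => E.act g (by rw [← h, map_smul])
  act_one := fun _ e => E.act_one _ e
  act_mul := fun g₁ g₂ _ _ _ _ _ _ e => E.act_mul g₁ g₂ _ _ _ e
  continuous_act := by
    let _ := pullbackTop f E.Fib
    refine continuous_into_pullback f E.Fib ?_ ?_
    · exact continuous_fst.smul ((continuous_pullback_proj f E.Fib).comp continuous_snd)
    · refine (E.continuous_act.comp (continuous_fst.prodMk
        ((continuous_pullback_lift f E.Fib).comp continuous_snd))).congr ?_
      exact fun q => (E.mk_act q.1 _ q.2.snd).symm
  act_smul := fun g _ _ _ a e => E.act_smul g _ a e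

/-- The pullback of a morphism. -/
def GABundle.Hom.pullback {𝒜 : GAlgBundle G X A} {E F : GABundle 𝒜} (φ : E.Hom F)
    (f : Y →[G] X) (hf : Continuous f) : (E.pullback f hf).Hom (F.pullback f hf) where
  map := fun y => φ.map (f y)
  continuous_map :=
    let _ := pullbackTop f E.Fib
    continuous_into_pullback f F.Fib (continuous_pullback_proj f E.Fib)
      (φ.continuous_map.comp (continuous_pullback_lift f E.Fib))
  map_act := fun g _ _ _ e => φ.map_act g _ e

theorem GABundle.IsDirectSum.pullback {𝒜 : GAlgBundle G X A} {E E₁ E₂ : GABundle 𝒜}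
    (h : E.IsDirectSum E₁ E₂) (f : Y →[G] X) (hf : Continuous f) :
    (E.pullback f hf).IsDirectSum (E₁.pullback f hf) (E₂.pullback f hf) := by
  obtain ⟨i₁, i₂, p₁, p₂, h⟩ := h
  exact ⟨i₁.pullback f hf, i₂.pullback f hf, p₁.pullback f hf, p₂.pullback f hf, fun y => h (f y)⟩

/-- The homomorphism `f^* : K_G^𝒜(X) → K_G^{f^*𝒜}(Y)`, `[E] ↦ [f^*E]`. -/
def KGroup.pullback (𝒜 : GAlgBundle G X A) (f : Y →[G] X) (hf : Continuous f) :
    KGroup 𝒜 →+ KGroup (𝒜.pullback f hf) :=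
  QuotientAddGroup.map _ _ (FreeAbelianGroup.map fun E => E.pullback f hf) <| by
    refine (AddSubgroup.closure_le _).2 ?_
    rintro _ ⟨E, E₁, E₂, h, rfl⟩
    refine AddSubgroup.subset_closure
      ⟨E.pullback f hf, E₁.pullback f hf, E₂.pullback f hf, h.pullback f hf, ?_⟩
    simp

theorem KGroup.pullback_mk (𝒜 : GAlgBundle G X A) (f : Y →[G] X) (hf : Continuous f)
    (E : GABundle 𝒜) : KGroup.pullback 𝒜 f hf (KGroup.mk E) = KGroup.mk (E.pullback f hf) := rfl

end Pullback

section Cylinder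

variable (G : Type w) (X : Type u) [Group G] [MulAction G X]

/-- The action of `G` on `X × I` by `g (x, t) = (g x, t)`. -/
instance cylinderAction : MulAction G (X × unitInterval) where
  smul g p := (g • p.1, p.2)
  one_smul p := Prod.ext (one_smul G p.1) rfl
  mul_smul g h p := Prod.ext (mul_smul g h p.1) rfl

instance [TopologicalSpace G] [TopologicalSpace X] [ContinuousSMul G X] :
    ContinuousSMul G (X × unitInterval) where
  continuous_smul := (continuous_fst.smul (continuous_fst.comp continuous_snd)).prodMk
    (continuous_snd.comp continuous_snd)

/-- The projection `X × I → X`, as an equivariant map. -/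
def cylinderProj : X × unitInterval →[G] X where
  toFun p := p.1
  map_smul' _ _ := rfl

theorem continuous_cylinderProj [TopologicalSpace X] : Continuous (cylinderProj G X) :=
  continuous_fst

end Cylinder

end TwistedK

end

noncomputable section

open MeasureTheory Topology

namespace TwistedK

/-! ### Continuity tested in local trivializations -/

section Charts

/-! The inverse of `p^*` is restriction to the level `0`. That it is a left inverse is immediate;
the content is that every bundle `E` on `X × I` is isomorphic to the pullback of its level `0`
(`KGroup.mk_cylinder_restrict`).

A partition of unity on the compact Hausdorff space `X × I` gives global sections `σ_k` and
coordinates `c_k`, finite in number, with `e = ∑ c_k(e) σ_k` (`GABundle.exists_frame`); they need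
not be invariant. They yield comparison maps `T e = ∑ c_k(e) σ_k(x, t)` from the fibre at `(x, s)`
to the fibre at `(x, t)`, equal to the identity when `s = t`. The mean of `g T g⁻¹` for the Haar
probability measure is equivariant and is still the identity when `s = t` (`meanTransport_act`,
`meanTransport_self`).

Being invertible is an open condition on such maps, although their source and target vary. Let `p`,
`q` be the idempotent matrices of the two fibres and `a = p a q` the matrix of the map. Then `a + (1
- p)(1 - q)` is `1` on the diagonal, and the map is an isomorphism as soon as this square matrix is
a unit (`ofMatrix_comp`, `comp_ofMatrix`). Units are open in the matrices over a Banach algebra, so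
compactness of `X` and `I` gives one `δ` that works for all `x` and all `s`, `t` at distance less
than `δ` (`eventually_isUnit`). Joining `0` to `s` by points that depend continuously on `s`, with
steps shorter than `δ`, and composing gives the isomorphism (`nonempty_iso_zero`). -/

theorem integrable_of_continuous {G B : Type*} [TopologicalSpace G] [CompactSpace G]
    [MeasurableSpace G] [OpensMeasurableSpace G] (μ : Measure G) [IsFiniteMeasure μ]
    [NormedAddCommGroup B] {f : G → B} (hf : Continuous f) : Integrable f μ :=
  hf.integrable_of_hasCompactSupport (HasCompactSupport.of_compactSpace f)

/-- Currying turns `f` into a continuous map to `C(G, B)` with the sup norm, on which integration is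
Lipschitz with constant `μ(G)`. Unlike dominated convergence, this asks no countability of `Z`. -/
theorem continuous_integral_of_compact {Z G B : Type*} [TopologicalSpace Z]
    [TopologicalSpace G] [CompactSpace G] [MeasurableSpace G] [OpensMeasurableSpace G]
    (μ : Measure G) [IsFiniteMeasure μ]
     [NormedAddCommGroup B] [NormedSpace ℝ B]
    {f : Z × G → B} (hf : Continuous f) : Continuous fun z => ∫ g, f (z, g) ∂μ := by
  let F : C(Z, C(G, B)) := ContinuousMap.curry ⟨f, hf⟩
  have hF (z : Z) : Integrable (F z) μ := integrable_of_continuous μ (F z).continuous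
  have : Continuous fun k : C(G, B) => ∫ g, k g ∂μ := by
    refine LipschitzWith.continuous (K := ⟨μ.real Set.univ, measureReal_nonneg⟩)
      (LipschitzWith.of_dist_le_mul fun k l => ?_)
    rw [dist_eq_norm, ← integral_sub (integrable_of_continuous μ k.continuous)
      (integrable_of_continuous μ l.continuous)]
    refine (norm_integral_le_of_norm_le_const (C := dist k l)
      (Filter.Eventually.of_forall fun g => ?_)).trans (mul_comm _ _).le
    rw [← dist_eq_norm]
    exact ContinuousMap.dist_apply_le_dist g
  exact this.comp F.continuous

theorem continuous_of_locally {Z W : Type*} [TopologicalSpace Z] [TopologicalSpace W] {f : Z → W}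
    (h : ∀ z, ∃ V : Set Z, IsOpen V ∧ z ∈ V ∧ Continuous fun y : V => f y) : Continuous f := by
  refine continuous_iff_continuousAt.2 fun z => ?_
  obtain ⟨V, hV, hz, hf⟩ := h z
  exact (continuousOn_iff_continuous_domRestrict.2 hf).continuousAt (hV.mem_nhds hz)

theorem IsLocalTriv.continuous_iff {X : Type u} [TopologicalSpace X] {E : X → Type v}
    [TopologicalSpace (Tot E)] {F : Type v} [TopologicalSpace F] {U : Set X} {ψ : ∀ y : U, E y ≃ F}
    (h : IsLocalTriv U ψ) {Z : Type*} [TopologicalSpace Z] {b : Z → X} (hb : Continuous b)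
    (hU : ∀ z, b z ∈ U) {f : ∀ z, E (b z)} :
    Continuous (fun z => (⟨b z, f z⟩ : Tot E)) ↔ Continuous fun z => ψ ⟨b z, hU z⟩ (f z) := by
  constructor
  · intro hf
    exact h.1.comp (hf.subtype_mk hU)
  · intro hf
    refine (h.2.comp ((hb.subtype_mk hU).prodMk hf)).congr fun z => ?_
    simp

variable {G : Type w} {X : Type u} {A : Type v} [Group G] [TopologicalSpace G]
  [TopologicalSpace X] [MulAction G X] [NormedRing A] [NormedAlgebra ℝ A]
  {𝒜 : GAlgBundle G X A} {Z : Type*} [TopologicalSpace Z] {b : Z → X}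

theorem GAlgBundle.continuous_of_charts (hb : Continuous b) {f : ∀ z, 𝒜.Fib (b z)}
    (h : ∀ (V : Set Z) (U : Set X) (φ : ∀ y : U, 𝒜.Fib y ≃ₐ[ℝ] A)
      (_ : IsLocalTriv U fun y => (φ y).toEquiv) (hV : ∀ z : V, b z ∈ U),
      Continuous fun z : V => φ ⟨b z, hV z⟩ (f z)) :
    Continuous fun z => (⟨b z, f z⟩ : Tot 𝒜.Fib) := by
  refine continuous_of_locally fun z => ?_
  obtain ⟨U, hU, hz, φ, hφ⟩ := 𝒜.exists_chart (b z)
  refine ⟨b ⁻¹' U, hU.preimage hb, hz, ?_⟩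
  exact (hφ.continuous_iff (hb.comp continuous_subtype_val) (fun y => y.2)).2
    (h (b ⁻¹' U) U φ hφ fun y => y.2)

theorem IsLocalTriv.continuous_algebra_chart {U : Set X} {φ : ∀ y : U, 𝒜.Fib y ≃ₐ[ℝ] A}
    (hφ : IsLocalTriv U fun y => (φ y).toEquiv) (hb : Continuous b) {f : ∀ z, 𝒜.Fib (b z)}
    (hf : Continuous fun z => (⟨b z, f z⟩ : Tot 𝒜.Fib)) {V : Set Z} (hV : ∀ z : V, b z ∈ U) :
    Continuous fun z : V => φ ⟨b z, hV z⟩ (f z) :=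
  (hφ.continuous_iff (hb.comp continuous_subtype_val) hV).1 (hf.comp continuous_subtype_val)

/-! ### Fibrewise operations in the algebra bundle -/

namespace GAlgBundle

theorem continuous_base {f : ∀ z, 𝒜.Fib (b z)}
    (hf : Continuous fun z => (⟨b z, f z⟩ : Tot 𝒜.Fib)) : Continuous b :=
  𝒜.continuous_proj.comp hf

theorem continuous_add {f g : ∀ z, 𝒜.Fib (b z)}
    (hf : Continuous fun z => (⟨b z, f z⟩ : Tot 𝒜.Fib))
    (hg : Continuous fun z => (⟨b z, g z⟩ : Tot 𝒜.Fib)) :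
    Continuous fun z => (⟨b z, f z + g z⟩ : Tot 𝒜.Fib) := by
  have hb := continuous_base hf
  refine continuous_of_charts hb fun V U φ hφ hV => ?_
  simp only [map_add]
  exact (hφ.continuous_algebra_chart hb hf hV).add (hφ.continuous_algebra_chart hb hg hV)

theorem continuous_sub {f g : ∀ z, 𝒜.Fib (b z)}
    (hf : Continuous fun z => (⟨b z, f z⟩ : Tot 𝒜.Fib))
    (hg : Continuous fun z => (⟨b z, g z⟩ : Tot 𝒜.Fib)) :
    Continuous fun z => (⟨b z, f z - g z⟩ : Tot 𝒜.Fib) := by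
  have hb := continuous_base hf
  refine continuous_of_charts hb fun V U φ hφ hV => ?_
  simp only [map_sub]
  exact (hφ.continuous_algebra_chart hb hf hV).sub (hφ.continuous_algebra_chart hb hg hV)

theorem continuous_mul {f g : ∀ z, 𝒜.Fib (b z)}
    (hf : Continuous fun z => (⟨b z, f z⟩ : Tot 𝒜.Fib))
    (hg : Continuous fun z => (⟨b z, g z⟩ : Tot 𝒜.Fib)) :
    Continuous fun z => (⟨b z, f z * g z⟩ : Tot 𝒜.Fib) := by
  have hb := continuous_base hf
  refine continuous_of_charts hb fun V U φ hφ hV => ?_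
  simp only [map_mul]
  exact (hφ.continuous_algebra_chart hb hf hV).mul (hφ.continuous_algebra_chart hb hg hV)

theorem continuous_algebraMap (hb : Continuous b) {r : Z → ℝ} (hr : Continuous r) :
    Continuous fun z => (⟨b z, algebraMap ℝ (𝒜.Fib (b z)) (r z)⟩ : Tot 𝒜.Fib) := by
  refine continuous_of_charts hb fun V U φ hφ hV => ?_
  simp only [AlgEquiv.commutes]
  exact (_root_.continuous_algebraMap ℝ A).comp (hr.comp continuous_subtype_val)

theorem continuous_zero (hb : Continuous b) :
    Continuous fun z => (⟨b z, 0⟩ : Tot 𝒜.Fib) := by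
  simpa using continuous_algebraMap (𝒜 := 𝒜) hb (continuous_const (y := (0 : ℝ)))

theorem continuous_one (hb : Continuous b) :
    Continuous fun z => (⟨b z, 1⟩ : Tot 𝒜.Fib) := by
  simpa using continuous_algebraMap (𝒜 := 𝒜) hb (continuous_const (y := (1 : ℝ)))

theorem continuous_sum (hb : Continuous b) {ι : Type*} (s : Finset ι) {f : ι → ∀ z, 𝒜.Fib (b z)}
    (hf : ∀ i, Continuous fun z => (⟨b z, f i z⟩ : Tot 𝒜.Fib)) :
    Continuous fun z => (⟨b z, ∑ i ∈ s, f i z⟩ : Tot 𝒜.Fib) := by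
  refine continuous_of_charts hb fun V U φ hφ hV => ?_
  simp only [map_sum]
  exact continuous_finsetSum _ fun i _ => hφ.continuous_algebra_chart hb (hf i) hV

theorem continuous_act_apply {g : Z → G} (hg : Continuous g) {f : ∀ z, 𝒜.Fib (b z)}
    (hf : Continuous fun z => (⟨b z, f z⟩ : Tot 𝒜.Fib)) {c : Z → X} (h : ∀ z, g z • b z = c z) :
    Continuous fun z => (⟨c z, 𝒜.act (g z) (h z) (f z)⟩ : Tot 𝒜.Fib) :=
  (𝒜.continuous_act.comp (hg.prodMk hf)).congr fun z => (𝒜.mk_act (g z) (h z) (f z)).symm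

/-! ### Inverting matrices over the fibres -/

section Matrices

attribute [local instance] Matrix.linftyOpNormedRing

theorem continuous_matrix_of_entries {A ι Y : Type*} [NormedRing A] [Fintype ι] [DecidableEq ι]
    [TopologicalSpace Y] {M : Y → Matrix ι ι A} (h : ∀ i j, Continuous fun y => M y i j) :
    Continuous M :=
  continuous_pi fun i => continuous_pi fun j => h i j

theorem hasSummableGeomSeries_matrix {A ι : Type*} [NormedRing A] [CompleteSpace A] [Fintype ι]
    [DecidableEq ι] : HasSummableGeomSeries (Matrix ι ι A) := by
  -- The uniformity of the operator norm unfolds to the product uniformity.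
  have : @CompleteSpace (Matrix ι ι A) PseudoMetricSpace.toUniformSpace :=
    inferInstanceAs (CompleteSpace (ι → ι → A))
  infer_instance

variable [CompleteSpace A] {ι : Type*} [Fintype ι] [DecidableEq ι]

/-- A chart carries `M` to units of the complete normed ring of matrices over `A`, where inversion
is continuous, and carries `N` to their inverses. -/
theorem continuous_inverse_matrix {M N : ∀ z, Matrix ι ι (𝒜.Fib (b z))} (hb : Continuous b)
    (hM : ∀ i j, Continuous fun z => (⟨b z, M z i j⟩ : Tot 𝒜.Fib))
    (h₁ : ∀ z, M z * N z = 1) (h₂ : ∀ z, N z * M z = 1) (i j : ι) :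
    Continuous fun z => (⟨b z, N z i j⟩ : Tot 𝒜.Fib) := by
  have := hasSummableGeomSeries_matrix (A := A) (ι := ι)
  refine continuous_of_charts hb fun V U φ hφ hV => ?_
  let M' : V → (Matrix ι ι A)ˣ := fun z =>
    ⟨(M z).map (φ ⟨b z, hV z⟩), (N z).map (φ ⟨b z, hV z⟩),
      by rw [← Matrix.map_mul, h₁, Matrix.map_one _ (map_zero _) (map_one _)],
      by rw [← Matrix.map_mul, h₂, Matrix.map_one _ (map_zero _) (map_one _)]⟩
  have hc : Continuous fun z => (M' z : Matrix ι ι A) :=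
    continuous_matrix_of_entries fun i j => hφ.continuous_algebra_chart hb (hM i j) hV
  have hc' : Continuous fun z => ((M' z)⁻¹ : (Matrix ι ι A)ˣ).1 := by
    refine continuous_iff_continuousAt.2 fun z => ?_
    have := ContinuousAt.comp (f := fun z => (M' z : Matrix ι ι A))
      (NormedRing.inverse_continuousAt (M' z)) hc.continuousAt
    refine this.congr (Filter.Eventually.of_forall fun y => ?_)
    exact Ring.inverse_unit (M' y)
  exact (continuous_apply_apply i j).comp hc'

/-- Charts are ring isomorphisms, hence preserve and reflect units; over a chart the set is the
preimage of the open set of units of the matrix ring over `A`. -/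
theorem isOpen_isUnit_matrix {M : ∀ z, Matrix ι ι (𝒜.Fib (b z))} (hb : Continuous b)
    (hM : ∀ i j, Continuous fun z => (⟨b z, M z i j⟩ : Tot 𝒜.Fib)) :
    IsOpen {z | IsUnit (M z)} := by
  have := hasSummableGeomSeries_matrix (A := A) (ι := ι)
  refine isOpen_iff_mem_nhds.2 fun z hz => ?_
  obtain ⟨U, hU, hzU, φ, hφ⟩ := 𝒜.exists_chart (b z)
  have hV : IsOpen (b ⁻¹' U) := hU.preimage hb
  have key (y : b ⁻¹' U) : IsUnit (M y) ↔ IsUnit ((M y).map (φ ⟨b y, y.2⟩)) :=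
    (MulEquiv.isUnit_map ((φ ⟨b y, y.2⟩).mapMatrix (m := ι))).symm
  have hc : Continuous fun y : b ⁻¹' U => (M y).map (φ ⟨b y, y.2⟩) :=
    continuous_matrix_of_entries fun i j =>
      hφ.continuous_algebra_chart hb (hM i j) fun y => y.2
  have ho : IsOpen {y : b ⁻¹' U | IsUnit (M y)} := by
    simp only [key]
    exact Units.isOpen.preimage hc
  have := hV.isOpenMap_subtype_val _ ho
  refine Filter.mem_of_superset (this.mem_nhds ⟨⟨z, hzU⟩, hz, rfl⟩) ?_
  rintro _ ⟨y, hy, rfl⟩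
  exact hy

end Matrices

/-! ### Integration over the group in a fibre -/

section Integral

variable (𝒜) in
/-- An identification of a fibre with the model Banach algebra. -/
def fibEquiv (x : X) : 𝒜.Fib x ≃ₐ[ℝ] A :=
  (𝒜.exists_chart x).choose_spec.2.2.choose ⟨x, (𝒜.exists_chart x).choose_spec.2.1⟩

theorem continuous_fibEquiv_iff {x : X} {f : Z → 𝒜.Fib x} :
    Continuous (fun z => (⟨x, f z⟩ : Tot 𝒜.Fib)) ↔ Continuous fun z => 𝒜.fibEquiv x (f z) :=
  (𝒜.exists_chart x).choose_spec.2.2.choose_spec.continuous_iff continuous_const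
    (b := fun _ => x) (fun _ => (𝒜.exists_chart x).choose_spec.2.1)

theorem continuous_fibEquiv_symm (x : X) :
    Continuous fun a : A => (⟨x, (𝒜.fibEquiv x).symm a⟩ : Tot 𝒜.Fib) :=
  continuous_fibEquiv_iff.2 (by simpa using continuous_id')

variable [MeasurableSpace G] (μ : Measure G)

/-- The integral of a function on `G` with values in a fibre of an algebra bundle. -/
def fibIntegral {x : X} (f : G → 𝒜.Fib x) : 𝒜.Fib x :=
  (𝒜.fibEquiv x).symm (∫ g, 𝒜.fibEquiv x (f g) ∂μ)

theorem fibEquiv_fibIntegral {x : X} (f : G → 𝒜.Fib x) :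
    𝒜.fibEquiv x (fibIntegral μ f) = ∫ g, 𝒜.fibEquiv x (f g) ∂μ := by
  simp [fibIntegral]

theorem fibIntegral_const [CompleteSpace A] [IsProbabilityMeasure μ] {x : X} (a : 𝒜.Fib x) :
    fibIntegral μ (fun _ => a) = a := by
  simp [fibIntegral]

theorem fibIntegral_mul_left [MeasurableMul G] [μ.IsMulLeftInvariant] {x : X} (f : G → 𝒜.Fib x)
    (g₀ : G) : fibIntegral μ (fun g => f (g₀ * g)) = fibIntegral μ f := by
  simp only [fibIntegral]
  rw [integral_mul_left_eq_self (fun g => 𝒜.fibEquiv x (f g))]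

variable [BorelSpace G] [CompactSpace G] [IsFiniteMeasure μ]

theorem fibIntegral_add {x : X} {f₁ f₂ : G → 𝒜.Fib x}
    (h₁ : Continuous fun g => (⟨x, f₁ g⟩ : Tot 𝒜.Fib))
    (h₂ : Continuous fun g => (⟨x, f₂ g⟩ : Tot 𝒜.Fib)) :
    fibIntegral μ (fun g => f₁ g + f₂ g) = fibIntegral μ f₁ + fibIntegral μ f₂ := by
  apply (𝒜.fibEquiv x).injective
  simp only [map_add, fibEquiv_fibIntegral]
  exact integral_add (integrable_of_continuous μ (continuous_fibEquiv_iff.1 h₁))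
    (integrable_of_continuous μ (continuous_fibEquiv_iff.1 h₂))

theorem fibIntegral_sum {x : X} {ι : Type*} (s : Finset ι) {f : ι → G → 𝒜.Fib x}
    (h : ∀ i, Continuous fun g => (⟨x, f i g⟩ : Tot 𝒜.Fib)) :
    fibIntegral μ (fun g => ∑ i ∈ s, f i g) = ∑ i ∈ s, fibIntegral μ (f i) := by
  apply (𝒜.fibEquiv x).injective
  simp only [map_sum, fibEquiv_fibIntegral]
  exact integral_finsetSum _ fun i _ =>
    integrable_of_continuous μ (continuous_fibEquiv_iff.1 (h i))

variable [CompleteSpace A]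

/-- Continuous linear maps commute with the Bochner integral. In particular every chart computes
`fibIntegral`, not only the chosen `fibEquiv`. -/
theorem apply_fibIntegral {x : X} (L : 𝒜.Fib x →ₗ[ℝ] A)
    (hL : Continuous fun a => L ((𝒜.fibEquiv x).symm a)) {f : G → 𝒜.Fib x}
    (h : Continuous fun g => (⟨x, f g⟩ : Tot 𝒜.Fib)) :
    L (fibIntegral μ f) = ∫ g, L (f g) ∂μ := by
  let L' : A →L[ℝ] A := ⟨L ∘ₗ (𝒜.fibEquiv x).symm.toLinearMap, hL⟩
  have := L'.integral_comp_comm (integrable_of_continuous μ (continuous_fibEquiv_iff.1 h))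
  refine this.symm.trans (integral_congr_ae (Filter.Eventually.of_forall fun g => ?_))
  exact congrArg L ((𝒜.fibEquiv x).symm_apply_apply (f g))

theorem map_fibIntegral {x x' : X} (T : 𝒜.Fib x →ₗ[ℝ] 𝒜.Fib x')
    (hT : Continuous fun a => (⟨x', T ((𝒜.fibEquiv x).symm a)⟩ : Tot 𝒜.Fib)) {f : G → 𝒜.Fib x}
    (h : Continuous fun g => (⟨x, f g⟩ : Tot 𝒜.Fib)) :
    T (fibIntegral μ f) = fibIntegral μ fun g => T (f g) := by
  apply (𝒜.fibEquiv x').injective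
  rw [fibEquiv_fibIntegral]
  exact apply_fibIntegral μ ((𝒜.fibEquiv x').toLinearMap ∘ₗ T) (continuous_fibEquiv_iff.1 hT) h

theorem act_fibIntegral (g₀ : G) {x x' : X} (hx : g₀ • x = x') {f : G → 𝒜.Fib x}
    (h : Continuous fun g => (⟨x, f g⟩ : Tot 𝒜.Fib)) :
    𝒜.act g₀ hx (fibIntegral μ f) = fibIntegral μ fun g => 𝒜.act g₀ hx (f g) :=
  map_fibIntegral μ (𝒜.act g₀ hx).toLinearMap
    (continuous_act_apply continuous_const (continuous_fibEquiv_symm x) fun _ => hx) h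

theorem mul_fibIntegral {x : X} (a : 𝒜.Fib x) {f : G → 𝒜.Fib x}
    (h : Continuous fun g => (⟨x, f g⟩ : Tot 𝒜.Fib)) :
    a * fibIntegral μ f = fibIntegral μ fun g => a * f g :=
  map_fibIntegral μ (LinearMap.mulLeft ℝ a)
    (continuous_mul continuous_const (continuous_fibEquiv_symm x)) h

theorem fibIntegral_mul {x : X} (a : 𝒜.Fib x) {f : G → 𝒜.Fib x}
    (h : Continuous fun g => (⟨x, f g⟩ : Tot 𝒜.Fib)) :
    fibIntegral μ f * a = fibIntegral μ fun g => f g * a :=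
  map_fibIntegral μ (LinearMap.mulRight ℝ a)
    (continuous_mul (continuous_fibEquiv_symm x) continuous_const) h

theorem fibIntegral_sum_mul {x : X} {ι : Type*} (s : Finset ι) (a : ι → 𝒜.Fib x)
    {f : ι → G → 𝒜.Fib x} (h : ∀ i, Continuous fun g => (⟨x, f i g⟩ : Tot 𝒜.Fib)) :
    fibIntegral μ (fun g => ∑ i ∈ s, f i g * a i) = ∑ i ∈ s, fibIntegral μ (f i) * a i := by
  rw [fibIntegral_sum μ s fun i => continuous_mul (g := fun _ => a i) (h i)
    continuous_const]
  exact Finset.sum_congr rfl fun i _ => (fibIntegral_mul μ (a i) (h i)).symm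

/-- The choices `fibEquiv x` are unrelated for different `x`. By `apply_fibIntegral` they can be
replaced by one chart near a given point, and the claim becomes continuity of an `A`-valued integral
with parameters. -/
theorem continuous_fibIntegral (hb : Continuous b) {f : ∀ z, G → 𝒜.Fib (b z)}
    (hf : Continuous fun p : Z × G => (⟨b p.1, f p.1 p.2⟩ : Tot 𝒜.Fib)) :
    Continuous fun z => (⟨b z, fibIntegral μ (f z)⟩ : Tot 𝒜.Fib) := by
  refine continuous_of_charts hb fun V U φ hφ hV => ?_
  have h₁ (z : V) : φ ⟨b z, hV z⟩ (fibIntegral μ (f z)) = ∫ g, φ ⟨b z, hV z⟩ (f z g) ∂μ := by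
    refine apply_fibIntegral μ (φ ⟨b z, hV z⟩).toLinearMap ?_
      (hf.comp (Continuous.prodMk_right z.1))
    exact (hφ.continuous_iff (b := fun _ => b z) continuous_const (fun _ => hV z)).1
      (continuous_fibEquiv_symm (b z))
  simp only [h₁]
  refine continuous_integral_of_compact μ
    (f := fun p : V × G => φ ⟨b p.1, hV p.1⟩ (f p.1 p.2)) ?_
  refine (hφ.continuous_iff (b := fun p : V × G => b p.1) ?_ fun p => hV p.1).1 ?_
  · fun_prop
  · exact hf.comp (f := fun p : V × G => (p.1.1, p.2)) (by fun_prop)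

end Integral

end GAlgBundle

/-! ### Fibrewise operations in a module bundle -/

namespace GABundle

variable {E : GABundle 𝒜}

theorem continuous_of_charts (hb : Continuous b) {f : ∀ z, E.Fib (b z)}
    (h : ∀ (V : Set Z) (U : Set X) (P : Type v) [AddCommGroup P] [Module A P] [TopologicalSpace P]
      [IsModuleTopology A P] (ψ : ∀ y : U, E.Fib y ≃+ P)
      (_ : IsLocalTriv U fun y => (ψ y).toEquiv) (hV : ∀ z : V, b z ∈ U),
      Continuous fun z : V => ψ ⟨b z, hV z⟩ (f z)) :
    Continuous fun z => (⟨b z, f z⟩ : Tot E.Fib) := by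
  refine continuous_of_locally fun z => ?_
  obtain ⟨U, hU, hz, φ, hφ, P, i₁, i₂, i₃, h₁, h₂, h₃, ψ, hψ, hs⟩ := E.exists_chart (b z)
  refine ⟨b ⁻¹' U, hU.preimage hb, hz, ?_⟩
  exact (hψ.continuous_iff (hb.comp continuous_subtype_val) (fun y => y.2)).2
    (h (b ⁻¹' U) U P ψ hψ fun y => y.2)

theorem _root_.TwistedK.IsLocalTriv.continuous_module_chart {U : Set X} {P : Type v}
    [AddCommGroup P] [TopologicalSpace P] {ψ : ∀ y : U, E.Fib y ≃+ P}
    (hψ : IsLocalTriv U fun y => (ψ y).toEquiv) (hb : Continuous b) {f : ∀ z, E.Fib (b z)}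
    (hf : Continuous fun z => (⟨b z, f z⟩ : Tot E.Fib)) {V : Set Z} (hV : ∀ z : V, b z ∈ U) :
    Continuous fun z : V => ψ ⟨b z, hV z⟩ (f z) :=
  (hψ.continuous_iff (hb.comp continuous_subtype_val) hV).1 (hf.comp continuous_subtype_val)

theorem continuous_sum (hb : Continuous b) {ι : Type*} (s : Finset ι) {f : ι → ∀ z, E.Fib (b z)}
    (hf : ∀ i, Continuous fun z => (⟨b z, f i z⟩ : Tot E.Fib)) :
    Continuous fun z => (⟨b z, ∑ i ∈ s, f i z⟩ : Tot E.Fib) := by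
  refine continuous_of_charts hb fun V U P _ _ _ _ ψ hψ hV => ?_
  have := IsModuleTopology.toContinuousAdd A P
  simp only [map_sum]
  exact continuous_finsetSum _ fun i _ => hψ.continuous_module_chart hb (hf i) hV

theorem continuous_zero (hb : Continuous b) :
    Continuous fun z => (⟨b z, 0⟩ : Tot E.Fib) := by
  simpa using continuous_sum (E := E) hb (∅ : Finset Unit) (f := fun _ _ => 0) (by
    refine fun _ => continuous_of_charts hb fun V U P _ _ _ _ ψ hψ hV => ?_
    simpa using continuous_const)

theorem continuous_smul_apply {a : ∀ z, 𝒜.Fib (b z)} {f : ∀ z, E.Fib (b z)}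
    (ha : Continuous fun z => (⟨b z, a z⟩ : Tot 𝒜.Fib))
    (hf : Continuous fun z => (⟨b z, f z⟩ : Tot E.Fib)) :
    Continuous fun z => (⟨b z, a z • f z⟩ : Tot E.Fib) :=
  E.continuous_smul.comp
    (Continuous.subtype_mk (p := fun q : Tot 𝒜.Fib × Tot E.Fib => q.1.proj = q.2.proj)
      (ha.prodMk hf) fun _ => rfl)

end GABundle

end Charts

/-! ### Finite frames from partitions of unity -/

section Frames

variable {G : Type w} {X : Type u} {A : Type v} [Group G] [TopologicalSpace G]
  [TopologicalSpace X] [MulAction G X] [NormedRing A] [NormedAlgebra ℝ A]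
  {𝒜 : GAlgBundle G X A}

/-- Global sections of a `G`-`𝒜` bundle together with dual coordinate functions (a continuous
dual basis), which present the bundle as a direct summand of a free one. No equivariance is
required. -/
structure GABundle.Frame (E : GABundle 𝒜) where
  ι : Type
  [fintype : Fintype ι]
  sec : ι → ∀ x, E.Fib x
  coord : ι → ∀ x, E.Fib x →ₗ[𝒜.Fib x] 𝒜.Fib x
  continuous_sec : ∀ k, Continuous fun x => (⟨x, sec k x⟩ : Tot E.Fib)
  continuous_coord : ∀ k, Continuous fun e : Tot E.Fib =>
    (⟨e.proj, coord k e.proj e.snd⟩ : Tot 𝒜.Fib)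
  sum_coord_smul_sec : ∀ x (e : E.Fib x), ∑ k, coord k x e • sec k x = e

attribute [instance] GABundle.Frame.fintype

/-- A frame of a `G`-`𝒜` bundle over a subset of the base. -/
structure GABundle.LocalFrame (E : GABundle 𝒜) (U : Set X) where
  n : ℕ
  sec : Fin n → ∀ x : U, E.Fib x
  coord : Fin n → ∀ x : U, E.Fib x →ₗ[𝒜.Fib x] 𝒜.Fib x
  continuous_sec : ∀ k, Continuous fun x : U => (⟨x, sec k x⟩ : Tot E.Fib)
  continuous_coord : ∀ k, Continuous fun e : {e : Tot E.Fib // e.proj ∈ U} =>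
    (⟨e.1.proj, coord k ⟨e.1.proj, e.2⟩ e.1.snd⟩ : Tot 𝒜.Fib)
  sum_coord_smul_sec : ∀ (x : U) (e : E.Fib x), ∑ k, coord k x e • sec k x = e

/-- The model `P` is a retract of some `A ^ n`, by `f` and `g` with `f ∘ g = id`. The images under
`f` of the basis vectors are the sections and the components of `g` the coordinates; `g` is
continuous because `P` has the module topology. -/
theorem GABundle.exists_localFrame (E : GABundle 𝒜) (x : X) :
    ∃ U : Set X, IsOpen U ∧ x ∈ U ∧ Nonempty (E.LocalFrame U) := by
  obtain ⟨U, hU, hx, φ, hφ, P, i₁, i₂, i₃, h₁, h₂, h₃, ψ, hψ, hs⟩ := E.exists_chart x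
  obtain ⟨n, f, g, -, -, hfg⟩ := Module.Finite.exists_comp_eq_id_of_projective A P
  have := IsModuleTopology.toContinuousAdd A P
  have := IsModuleTopology.toContinuousSMul A P
  have hg : Continuous g := IsModuleTopology.continuous_of_linearMap g
  refine ⟨U, hU, hx, ⟨{
    n := n
    sec := fun i y => (ψ y).symm (f (Pi.single i 1))
    coord := fun i y =>
      { toFun := fun e => (φ y).symm (g (ψ y e) i)
        map_add' := fun e e' => by simp
        map_smul' := fun a e => by simp [hs] }
    continuous_sec := fun i => ?_
    continuous_coord := fun i => ?_
    sum_coord_smul_sec := fun y e => ?_ }⟩⟩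
  · refine (hψ.continuous_iff continuous_subtype_val fun y => y.2).2 ?_
    simpa using continuous_const
  · refine (hφ.continuous_iff (E.continuous_proj.comp continuous_subtype_val) fun e => e.2).2 ?_
    simpa [Function.comp_def] using (continuous_apply i).comp (hg.comp hψ.1)
  · apply (ψ y).injective
    simp only [LinearMap.coe_mk, AddHom.coe_mk, map_sum, hs, AlgEquiv.apply_symm_apply,
      AddEquiv.apply_symm_apply]
    have h (p : Fin n → A) : ∑ i, p i • f (Pi.single i 1) = f p := by
      conv_rhs => rw [pi_eq_sum_univ' p, map_sum]
      exact Finset.sum_congr rfl fun i _ => (map_smul f _ _).symm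
    rw [h]
    exact LinearMap.congr_fun hfg (ψ y e)

/-- Extension by zero: `U` and the complement of the support of `r` form an open cover, and `s` is
continuous on each. -/
theorem GABundle.continuous_cutoff_section {E : GABundle 𝒜} {U : Set X} (hU : IsOpen U)
    {r : X → ℝ} (hr : Continuous r) (hrU : tsupport r ⊆ U) {s : ∀ x, E.Fib x}
    {s' : ∀ x : U, E.Fib x} (hs' : Continuous fun x : U => (⟨x, s' x⟩ : Tot E.Fib))
    (hs : ∀ x : U, s x = algebraMap ℝ (𝒜.Fib x) (r x) • s' x) (h0 : ∀ x, r x = 0 → s x = 0) :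
    Continuous fun x => (⟨x, s x⟩ : Tot E.Fib) := by
  refine continuous_of_locally fun x => ?_
  by_cases hx : x ∈ U
  · refine ⟨U, hU, hx, ?_⟩
    simp only [hs]
    exact continuous_smul_apply (GAlgBundle.continuous_algebraMap continuous_subtype_val
      (hr.comp continuous_subtype_val)) hs'
  · refine ⟨(tsupport r)ᶜ, (isClosed_tsupport r).isOpen_compl, fun h => hx (hrU h), ?_⟩
    refine (continuous_zero (E := E) (b := fun y : ((tsupport r)ᶜ : Set X) => (y : X))
      continuous_subtype_val).congr fun y => ?_
    rw [h0 y (image_eq_zero_of_notMem_tsupport y.2)]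

theorem GABundle.continuous_cutoff_coord {E : GABundle 𝒜} {U : Set X} (hU : IsOpen U)
    {r : X → ℝ} (hr : Continuous r) (hrU : tsupport r ⊆ U) {c : ∀ x, E.Fib x →ₗ[𝒜.Fib x] 𝒜.Fib x}
    {c' : ∀ x : U, E.Fib x → 𝒜.Fib x}
    (hc' : Continuous fun e : {e : Tot E.Fib // e.proj ∈ U} =>
      (⟨e.1.proj, c' ⟨e.1.proj, e.2⟩ e.1.snd⟩ : Tot 𝒜.Fib))
    (hc : ∀ (x : U) (e : E.Fib x), c x e = algebraMap ℝ (𝒜.Fib x) (r x) * c' x e)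
    (h0 : ∀ x e, r x = 0 → c x e = 0) :
    Continuous fun e : Tot E.Fib => (⟨e.proj, c e.proj e.snd⟩ : Tot 𝒜.Fib) := by
  have hp := E.continuous_proj
  refine continuous_of_locally fun e => ?_
  by_cases hx : e.proj ∈ U
  · refine ⟨TotalSpace.proj ⁻¹' U, hU.preimage hp, hx, ?_⟩
    refine (GAlgBundle.continuous_mul (GAlgBundle.continuous_algebraMap (𝒜 := 𝒜)
      (hp.comp continuous_subtype_val) (hr.comp (hp.comp continuous_subtype_val))) hc').congr ?_
    rintro ⟨⟨x, e⟩, hx⟩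
    exact congrArg (fun a => (⟨x, a⟩ : Tot 𝒜.Fib)) (hc ⟨x, hx⟩ e).symm
  · refine ⟨TotalSpace.proj ⁻¹' (tsupport r)ᶜ, (isClosed_tsupport r).isOpen_compl.preimage hp,
      fun h => hx (hrU h), ?_⟩
    refine (GAlgBundle.continuous_zero (𝒜 := 𝒜) (hp.comp continuous_subtype_val)).congr ?_
    rintro ⟨⟨x, e⟩, hx⟩
    exact congrArg (fun a => (⟨x, a⟩ : Tot 𝒜.Fib))
      (h0 x e (image_eq_zero_of_notMem_tsupport hx)).symm

theorem GABundle.exists_frame [CompactSpace X] [T2Space X] (E : GABundle 𝒜) :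
    Nonempty E.Frame := by
  classical
  choose U hU hxU hF using E.exists_localFrame
  obtain ⟨t, ht⟩ := isCompact_univ.elim_finite_subcover U hU
    fun x _ => Set.mem_iUnion.2 ⟨x, hxU x⟩
  let V : Fin t.card → Set X := fun j => U (t.equivFin.symm j)
  have hV (j) : IsOpen (V j) := hU _
  have L (j) : E.LocalFrame (V j) := (hF _).some
  obtain ⟨f, hfV, hf1, hf01, -⟩ := exists_continuous_sum_one_of_isOpen_isCompact (s := V)
    hV isCompact_univ (fun x hx => by
      obtain ⟨y, hy, hxy⟩ := Set.mem_iUnion₂.1 (ht hx)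
      exact Set.mem_iUnion.2 ⟨t.equivFin ⟨y, hy⟩, by simpa [V] using hxy⟩)
  -- Sections and coordinates are both multiplied by the square root, so that their products carry
  -- the weights `f j`, with sum `1`.
  let r : Fin t.card → X → ℝ := fun j x => √(f j x)
  have hrc (j) : Continuous (r j) := (f j).continuous.sqrt
  have hrV (j) : tsupport (r j) ⊆ V j := by
    refine (closure_mono fun x hx => ?_).trans (hfV j)
    intro h0
    exact hx (by simp [r, h0])
  have hr0 (j x) (hx : x ∉ V j) : r j x = 0 :=
    image_eq_zero_of_notMem_tsupport fun h => hx (hrV j h)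
  let c : ∀ (k : Σ j, Fin (L j).n) (x : X), E.Fib x →ₗ[𝒜.Fib x] 𝒜.Fib x := fun k x =>
    if h : x ∈ V k.1 then
      { toFun := fun e => algebraMap ℝ (𝒜.Fib x) (r k.1 x) * (L k.1).coord k.2 ⟨x, h⟩ e
        map_add' := fun e e' => by simp [mul_add]
        map_smul' := fun a e => by
          simp only [map_smul, smul_eq_mul, RingHom.id_apply]
          -- Real scalars are central, so the cut-off coordinate remains left linear.
          rw [← mul_assoc, Algebra.commutes, mul_assoc] } else 0
  refine ⟨{
    ι := Σ j, Fin (L j).n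
    sec := fun k x => if h : x ∈ V k.1 then
      algebraMap ℝ (𝒜.Fib x) (r k.1 x) • (L k.1).sec k.2 ⟨x, h⟩ else 0
    coord := c
    continuous_sec := fun k => ?_
    continuous_coord := fun k => ?_
    sum_coord_smul_sec := fun x e => ?_ }⟩
  · refine continuous_cutoff_section (hV k.1) (hrc k.1) (hrV k.1) ((L k.1).continuous_sec k.2)
      (fun x => by simp) (fun x hx => ?_)
    split_ifs <;> simp [hx]
  · refine continuous_cutoff_coord (c := c k) (c' := fun x e => (L k.1).coord k.2 x e)
      (hV k.1) (hrc k.1) (hrV k.1) ((L k.1).continuous_coord k.2) (fun x e => ?_) (fun x e hx => ?_)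
    · simp [c]
    · simp only [c]
      split_ifs <;> simp [hx]
  · rw [Fintype.sum_sigma]
    have key (j) : ∀ (h : x ∈ V j), ∑ i, (algebraMap ℝ (𝒜.Fib x) (r j x) *
        (L j).coord i ⟨x, h⟩ e) • (algebraMap ℝ (𝒜.Fib x) (r j x) • (L j).sec i ⟨x, h⟩) =
        algebraMap ℝ (𝒜.Fib x) (f j x) • e := by
      intro h
      have hsq : r j x * r j x = f j x := Real.mul_self_sqrt (hf01 j x).1
      rw [← hsq, map_mul]
      conv_rhs => rw [← (L j).sum_coord_smul_sec ⟨x, h⟩ e, Finset.smul_sum]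
      refine Finset.sum_congr rfl fun i _ => ?_
      rw [smul_smul, smul_smul, mul_assoc, mul_assoc, Algebra.commutes (r j x)
        ((L j).coord i ⟨x, h⟩ e)]
    have hsum : ∑ j, algebraMap ℝ (𝒜.Fib x) (f j x) • e = e := by
      rw [← Finset.sum_smul, ← map_sum]
      have := hf1 (Set.mem_univ x)
      simp only [Finset.sum_apply, Pi.one_apply] at this
      rw [this, map_one, one_smul]
    refine Eq.trans (Finset.sum_congr rfl fun j _ => ?_) hsum
    by_cases h : x ∈ V j
    · simp only [c, h, dite_true]
      exact key j h
    · have h0 : f j x = 0 := image_eq_zero_of_notMem_tsupport fun h' => h (hfV j h')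
      simp [c, h, h0]

end Frames

/-! ### Families of equivariant modules in frame coordinates -/

section Families

variable {G : Type w} {X : Type u} {A : Type v} [Group G] [TopologicalSpace G]
  [TopologicalSpace X] [MulAction G X] [NormedRing A] [NormedAlgebra ℝ A]

/-- A family, parametrized by `T`, of equivariant modules over an algebra bundle `𝒜`, presented
by a frame. The topology is encoded in the matrix entries of the action. -/
structure FramedFamily (𝒜 : GAlgBundle G X A) (T : Type*) [TopologicalSpace T] where
  Fib : X → T → Type v
  [addCommGroup : ∀ x t, AddCommGroup (Fib x t)]
  [module : ∀ x t, Module (𝒜.Fib x) (Fib x t)]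
  act : ∀ (g : G) {x x' : X}, g • x = x' → ∀ t, Fib x t →+ Fib x' t
  act_one : ∀ {x : X} (h : (1 : G) • x = x) (t : T) (e : Fib x t), act 1 h t e = e
  act_mul : ∀ (g₁ g₂ : G) {x x' x'' : X} (h₂ : g₂ • x = x') (h₁ : g₁ • x' = x'')
    (h : (g₁ * g₂) • x = x'') (t : T) (e : Fib x t),
    act (g₁ * g₂) h t e = act g₁ h₁ t (act g₂ h₂ t e)
  act_smul : ∀ (g : G) {x x' : X} (h : g • x = x') (t : T) (a : 𝒜.Fib x) (e : Fib x t),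
    act g h t (a • e) = 𝒜.act g h a • act g h t e
  ι : Type
  [fintype : Fintype ι]
  sec : ι → ∀ x t, Fib x t
  coord : ι → ∀ x t, Fib x t →ₗ[𝒜.Fib x] 𝒜.Fib x
  sum_coord_smul_sec : ∀ x t (e : Fib x t), ∑ k, coord k x t e • sec k x t = e
  continuous_coord_act : ∀ k l, Continuous fun q : G × X × T =>
    (⟨q.1 • q.2.1, coord l (q.1 • q.2.1) q.2.2 (act q.1 rfl q.2.2 (sec k q.2.1 q.2.2))⟩ :
      Tot 𝒜.Fib)

attribute [instance] FramedFamily.addCommGroup FramedFamily.module FramedFamily.fintype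

namespace FramedFamily

variable {𝒜 : GAlgBundle G X A} {T : Type*} [TopologicalSpace T] (E : FramedFamily 𝒜 T)

theorem ext_coord {x : X} {t : T} {e e' : E.Fib x t}
    (h : ∀ k, E.coord k x t e = E.coord k x t e') : e = e' := by
  rw [← E.sum_coord_smul_sec x t e, ← E.sum_coord_smul_sec x t e']
  simp only [h]

theorem map_eq_sum {x : X} {t : T} {M : Type*} [AddCommGroup M] [Module (𝒜.Fib x) M]
    (L : E.Fib x t →ₗ[𝒜.Fib x] M) (e : E.Fib x t) :
    L e = ∑ k, E.coord k x t e • L (E.sec k x t) := by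
  conv_lhs => rw [← E.sum_coord_smul_sec x t e, map_sum]
  simp only [map_smul]

theorem act_eq_sum (g : G) {x x' : X} (h : g • x = x') (t : T) (e : E.Fib x t) :
    E.act g h t e = ∑ k, 𝒜.act g h (E.coord k x t e) • E.act g h t (E.sec k x t) := by
  conv_lhs => rw [← E.sum_coord_smul_sec x t e, map_sum]
  simp only [act_smul]

theorem act_of_eq_one {g : G} (hg : g = 1) {x : X} (h : g • x = x) (t : T) (e : E.Fib x t) :
    E.act g h t e = e := by
  subst hg
  exact E.act_one h t e

theorem act_act_inv (g : G) {x x' : X} (h : g • x' = x) (h' : g⁻¹ • x = x') (t : T)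
    (e : E.Fib x t) : E.act g h t (E.act g⁻¹ h' t e) = e := by
  rw [← E.act_mul g g⁻¹ h' h (by simp)]
  exact E.act_of_eq_one (mul_inv_cancel g) _ t e

theorem _root_.TwistedK.GAlgBundle.act_act_inv (𝒜 : GAlgBundle G X A) (g : G) {x x' : X}
    (h : g • x' = x) (h' : g⁻¹ • x = x') (a : 𝒜.Fib x) : 𝒜.act g h (𝒜.act g⁻¹ h' a) = a := by
  have aux : ∀ {k : G} (hk : k = 1) (hx : k • x = x), 𝒜.act k hx a = a := by
    rintro _ rfl hx
    exact 𝒜.act_one hx a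
  rw [← 𝒜.act_mul g g⁻¹ h' h (by simp)]
  exact aux (mul_inv_cancel g) _

section Continuity

variable {Z : Type*} [TopologicalSpace Z]

/-- Continuity of a family of vectors, expressed by its coordinates. -/
def ContinuousAlong (b : Z → X) (t : Z → T) (e : ∀ z, E.Fib (b z) (t z)) : Prop :=
  ∀ k, Continuous fun z => (⟨b z, E.coord k (b z) (t z) (e z)⟩ : Tot 𝒜.Fib)

variable {E} {b : Z → X} {s t : Z → T}

theorem ContinuousAlong.comp {W : Type*} [TopologicalSpace W] {e : ∀ z, E.Fib (b z) (t z)}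
    (he : E.ContinuousAlong b t e) {f : W → Z} (hf : Continuous f) :
    E.ContinuousAlong (fun y => b (f y)) (fun y => t (f y)) fun y => e (f y) :=
  fun k => (he k).comp hf

theorem continuousAlong_act_sec {g : Z → G} (hg : Continuous g) (hb : Continuous b)
    (ht : Continuous t) {c : Z → X} (h : ∀ z, g z • b z = c z) (k : E.ι) :
    E.ContinuousAlong c t fun z => E.act (g z) (h z) (t z) (E.sec k (b z) (t z)) := by
  obtain rfl : (fun z => g z • b z) = c := funext h
  exact fun l => (E.continuous_coord_act k l).comp (hg.prodMk (hb.prodMk ht))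

/-- The entries `coord l (sec k)` of the idempotent are the entries of the action at `g = 1`, so
their continuity is part of `continuous_coord_act`. -/
theorem continuousAlong_sec (hb : Continuous b) (ht : Continuous t) (k : E.ι) :
    E.ContinuousAlong b t fun z => E.sec k (b z) (t z) := by
  have := continuousAlong_act_sec (E := E) (g := fun _ : Z => (1 : G)) continuous_const hb ht
    (fun z => one_smul G (b z)) k
  simpa only [act_one] using this

/-- The coordinates of `L e` are the row of coordinates of `e` times the matrix of `L`, so `L` only
has to be tested on the frame. -/
theorem ContinuousAlong.linearMap {e : ∀ z, E.Fib (b z) (s z)} (hb : Continuous b)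
    (he : E.ContinuousAlong b s e) {L : ∀ z, E.Fib (b z) (s z) →ₗ[𝒜.Fib (b z)] E.Fib (b z) (t z)}
    (hL : ∀ k, E.ContinuousAlong b t fun z => L z (E.sec k (b z) (s z))) :
    E.ContinuousAlong b t fun z => L z (e z) := by
  intro l
  have h (z) : E.coord l (b z) (t z) (L z (e z)) = ∑ k, E.coord k (b z) (s z) (e z) *
      E.coord l (b z) (t z) (L z (E.sec k (b z) (s z))) := by
    rw [E.map_eq_sum (L z) (e z), map_sum]
    simp
  simp only [h]
  exact GAlgBundle.continuous_sum hb _ fun k => GAlgBundle.continuous_mul (he k) (hL k l)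

theorem coord_act (l : E.ι) (g : G) {x x' : X} (h : g • x = x') (t : T) (e : E.Fib x t) :
    E.coord l x' t (E.act g h t e) =
      ∑ k, 𝒜.act g h (E.coord k x t e) * E.coord l x' t (E.act g h t (E.sec k x t)) := by
  rw [E.act_eq_sum, map_sum]
  simp

theorem ContinuousAlong.act {e : ∀ z, E.Fib (b z) (t z)} (hb : Continuous b) (ht : Continuous t)
    (he : E.ContinuousAlong b t e) {g : Z → G} (hg : Continuous g) {c : Z → X} (hc : Continuous c)
    (h : ∀ z, g z • b z = c z) :
    E.ContinuousAlong c t fun z => E.act (g z) (h z) (t z) (e z) := by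
  intro l
  refine (GAlgBundle.continuous_sum hc Finset.univ fun k => GAlgBundle.continuous_mul
    (GAlgBundle.continuous_act_apply hg (he k) h)
    (continuousAlong_act_sec hg hb ht h k l)).congr fun z => ?_
  rw [coord_act l]

end Continuity

/-! ### Averaging vectors over the group -/

section Averaging

variable {E} [MeasurableSpace G] (μ : Measure G)

/-- The mean of a function on `G` with values in a fibre. -/
def avg {x : X} {t : T} (f : G → E.Fib x t) : E.Fib x t :=
  ∑ k, GAlgBundle.fibIntegral μ (fun g => E.coord k x t (f g)) • E.sec k x t

theorem avg_mul_left [MeasurableMul G] [μ.IsMulLeftInvariant] {x : X} {t : T}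
    (f : G → E.Fib x t) (g₀ : G) : avg μ (fun g => f (g₀ * g)) = avg μ f :=
  Finset.sum_congr rfl fun k _ => by
    rw [GAlgBundle.fibIntegral_mul_left μ (fun g => E.coord k x t (f g))]

theorem avg_const [CompleteSpace A] [IsProbabilityMeasure μ] {x : X} {t : T} (e : E.Fib x t) :
    avg μ (fun _ => e) = e := by
  simp [avg, GAlgBundle.fibIntegral_const, E.sum_coord_smul_sec]

variable [BorelSpace G] [CompactSpace G] [IsFiniteMeasure μ]

theorem avg_add {x : X} {t : T} {f₁ f₂ : G → E.Fib x t}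
    (h₁ : E.ContinuousAlong (fun _ => x) (fun _ => t) f₁)
    (h₂ : E.ContinuousAlong (fun _ => x) (fun _ => t) f₂) :
    avg μ (fun g => f₁ g + f₂ g) = avg μ f₁ + avg μ f₂ := by
  simp only [avg, map_add, ← Finset.sum_add_distrib, ← add_smul]
  exact Finset.sum_congr rfl fun k _ => by rw [GAlgBundle.fibIntegral_add μ (h₁ k) (h₂ k)]

variable [CompleteSpace A]

theorem avg_smul {x : X} {t : T} (a : 𝒜.Fib x) {f : G → E.Fib x t}
    (h : E.ContinuousAlong (fun _ => x) (fun _ => t) f) :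
    avg μ (fun g => a • f g) = a • avg μ f := by
  simp only [avg, map_smul, Finset.smul_sum, smul_smul, smul_eq_mul]
  exact Finset.sum_congr rfl fun k _ => by rw [GAlgBundle.mul_fibIntegral μ a (h k)]

/-- Frame coordinates are redundant, so this is not the definition of `avg`. It holds because a
coordinate row is fixed by the idempotent `coord l (sec k)`, and right multiplication by its entries
commutes with the integral. -/
theorem coord_avg {x : X} {t : T} {f : G → E.Fib x t}
    (h : E.ContinuousAlong (fun _ => x) (fun _ => t) f) (l : E.ι) :
    E.coord l x t (avg μ f) = GAlgBundle.fibIntegral μ fun g => E.coord l x t (f g) := by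
  have h' (k) : Continuous fun g => (⟨x, E.coord k x t (f g)⟩ : Tot 𝒜.Fib) := h k
  simp only [E.map_eq_sum (E.coord l x t) (f _), smul_eq_mul]
  rw [GAlgBundle.fibIntegral_sum_mul μ _ _ h']
  simp only [avg, map_sum, map_smul, smul_eq_mul]

theorem act_avg (g₀ : G) {x x' : X} (hx : g₀ • x = x') {t : T} {f : G → E.Fib x t}
    (h : E.ContinuousAlong (fun _ => x) (fun _ => t) f) :
    E.act g₀ hx t (avg μ f) = avg μ fun g => E.act g₀ hx t (f g) := by
  refine E.ext_coord fun l => ?_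
  have h' : E.ContinuousAlong (fun _ => x') (fun _ => t) fun g => E.act g₀ hx t (f g) :=
    h.act continuous_const continuous_const continuous_const continuous_const fun _ => hx
  have h₁ (k) : Continuous fun g => (⟨x', 𝒜.act g₀ hx (E.coord k x t (f g))⟩ : Tot 𝒜.Fib) :=
    GAlgBundle.continuous_act_apply continuous_const (h k) fun _ => hx
  rw [coord_avg μ h', coord_act]
  simp only [coord_act l g₀ hx t (f _)]
  rw [GAlgBundle.fibIntegral_sum_mul μ _ _ h₁]
  refine Finset.sum_congr rfl fun k _ => ?_
  rw [coord_avg μ h, GAlgBundle.act_fibIntegral μ g₀ hx (h k)]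

theorem ContinuousAlong.avg {Z : Type*} [TopologicalSpace Z] {b : Z → X} {t : Z → T}
    (hb : Continuous b) {f : ∀ z, G → E.Fib (b z) (t z)}
    (h : E.ContinuousAlong (fun p : Z × G => b p.1) (fun p => t p.1) fun p => f p.1 p.2) :
    E.ContinuousAlong b t fun z => FramedFamily.avg μ (f z) := by
  intro k
  have h₁ (z) : E.coord k (b z) (t z) (FramedFamily.avg μ (f z)) =
      GAlgBundle.fibIntegral μ fun g => E.coord k (b z) (t z) (f z g) := by
    refine coord_avg μ (fun l => ?_) k
    exact (h l).comp (Continuous.prodMk_right z)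
  simp only [h₁]
  exact GAlgBundle.continuous_fibIntegral μ hb (h k)

end Averaging

/-! ### Comparison of fibres and conjugation by the group -/

section Transport

/-- The comparison map between two fibres over the same point, given by the frame. -/
def transport (x : X) (s t : T) : E.Fib x s →ₗ[𝒜.Fib x] E.Fib x t :=
  ∑ k, (E.coord k x s).smulRight (E.sec k x t)

theorem transport_apply (x : X) (s t : T) (e : E.Fib x s) :
    E.transport x s t e = ∑ k, E.coord k x s e • E.sec k x t := by
  simp [transport]

theorem transport_self (x : X) (t : T) (e : E.Fib x t) : E.transport x t t e = e := by
  rw [transport_apply, E.sum_coord_smul_sec]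

variable {E} in
theorem ContinuousAlong.transport {Z : Type*} [TopologicalSpace Z] {b : Z → X} {s t : Z → T}
    (hb : Continuous b) (ht : Continuous t) {e : ∀ z, E.Fib (b z) (s z)}
    (he : E.ContinuousAlong b s e) :
    E.ContinuousAlong b t fun z => E.transport (b z) (s z) (t z) (e z) := by
  intro l
  simp only [E.transport_apply, map_sum, map_smul, smul_eq_mul]
  exact GAlgBundle.continuous_sum hb _ fun k => GAlgBundle.continuous_mul (he k)
    (continuousAlong_sec hb ht k l)

/-- The conjugate of the comparison map by an element of the group. -/
def conj (g : G) (x : X) (s t : T) (e : E.Fib x s) : E.Fib x t :=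
  E.act g (smul_inv_smul g x) t (E.transport (g⁻¹ • x) s t (E.act g⁻¹ rfl s e))

theorem conj_eq (g : G) (x : X) (s t : T) (e : E.Fib x s) {y : X} (hy : g⁻¹ • x = y)
    (hy' : g • y = x) :
    E.conj g x s t e = E.act g hy' t (E.transport y s t (E.act g⁻¹ hy s e)) := by
  subst hy
  rfl

theorem conj_self (g : G) (x : X) (t : T) (e : E.Fib x t) : E.conj g x t t e = e := by
  rw [conj, transport_self, act_act_inv]

theorem conj_add (g : G) (x : X) (s t : T) (e e' : E.Fib x s) :
    E.conj g x s t (e + e') = E.conj g x s t e + E.conj g x s t e' := by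
  simp [conj]

/-- The action is only semilinear, but the twists by `g⁻¹` and `g` cancel. -/
theorem conj_smul (g : G) (x : X) (s t : T) (a : 𝒜.Fib x) (e : E.Fib x s) :
    E.conj g x s t (a • e) = a • E.conj g x s t e := by
  simp only [conj, act_smul, map_smul, GAlgBundle.act_act_inv]

/-- Moving `g₀` across the conjugate shifts the index to `g₀⁻¹ * g`; a left invariant mean absorbs
the shift. -/
theorem conj_act (g g₀ : G) {x x' : X} (h : g₀ • x = x') (s t : T) (e : E.Fib x s) :
    E.conj g x' s t (E.act g₀ h s e) = E.act g₀ h t (E.conj (g₀⁻¹ * g) x s t e) := by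
  subst h
  have hy : (g₀⁻¹ * g)⁻¹ • x = g⁻¹ • g₀ • x := by simp [mul_smul]
  have hy' : (g₀⁻¹ * g) • g⁻¹ • g₀ • x = x := by simp [mul_smul]
  have h₁ : E.act g⁻¹ rfl s (E.act g₀ rfl s e) = E.act (g₀⁻¹ * g)⁻¹ hy s e := by
    rw [← E.act_mul g⁻¹ g₀ rfl rfl (mul_smul _ _ _)]
    congr! 1
    simp
  rw [E.conj_eq _ x s t e hy hy', conj, h₁, ← E.act_mul g₀ (g₀⁻¹ * g) hy' rfl (by simp)]
  congr! 1
  simp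

end Transport

end FramedFamily

end Families

namespace FramedFamily

variable {G : Type w} {X : Type u} {A : Type v} [Group G] [TopologicalSpace G]
  [TopologicalSpace X] [MulAction G X] [NormedRing A] [NormedAlgebra ℝ A]
  {𝒜 : GAlgBundle G X A}

/-! ### Linear maps between fibres as matrices -/

section Matrices

variable {T : Type*} [TopologicalSpace T] (E : FramedFamily 𝒜 T)

/-- The matrix of a linear map in the frame. -/
def toMatrix {x : X} {s t : T} (L : E.Fib x s →ₗ[𝒜.Fib x] E.Fib x t) :
    Matrix E.ι E.ι (𝒜.Fib x) :=
  Matrix.of fun k l => E.coord l x t (L (E.sec k x s))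

/-- The linear map with a given matrix. -/
def ofMatrix {x : X} (s t : T) (M : Matrix E.ι E.ι (𝒜.Fib x)) :
    E.Fib x s →ₗ[𝒜.Fib x] E.Fib x t :=
  ∑ k, ∑ l, (E.coord k x s).smulRight (M k l • E.sec l x t)

variable {E} {x : X} {s t r : T}

/-- The order is reversed because coordinates over a left module are row vectors. -/
theorem toMatrix_comp (L : E.Fib x s →ₗ[𝒜.Fib x] E.Fib x t)
    (M : E.Fib x t →ₗ[𝒜.Fib x] E.Fib x r) : E.toMatrix (M ∘ₗ L) = E.toMatrix L * E.toMatrix M := by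
  ext k l
  simp only [toMatrix, Matrix.of_apply, Matrix.mul_apply, LinearMap.comp_apply]
  rw [E.map_eq_sum M, map_sum]
  simp

theorem toMatrix_injective :
    Function.Injective (E.toMatrix : (E.Fib x s →ₗ[𝒜.Fib x] E.Fib x t) → _) := by
  intro L M h
  ext e
  rw [E.map_eq_sum L, E.map_eq_sum M]
  refine Finset.sum_congr rfl fun k _ => ?_
  congr 1
  exact E.ext_coord fun l => congrFun (congrFun h k) l

theorem toMatrix_ofMatrix (M : Matrix E.ι E.ι (𝒜.Fib x)) :
    E.toMatrix (E.ofMatrix s t M) = E.toMatrix (LinearMap.id : E.Fib x s →ₗ[𝒜.Fib x] _) * M *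
      E.toMatrix (LinearMap.id : E.Fib x t →ₗ[𝒜.Fib x] _) := by
  ext k l
  simp only [toMatrix, ofMatrix, Matrix.of_apply, Matrix.mul_apply, LinearMap.id_apply,
    LinearMap.sum_apply, LinearMap.smulRight_apply, map_sum, map_smul, smul_eq_mul,
    Finset.sum_mul, mul_assoc]
  exact Finset.sum_comm

theorem toMatrix_id_mul_self :
    E.toMatrix (LinearMap.id : E.Fib x s →ₗ[𝒜.Fib x] _) *
      E.toMatrix (LinearMap.id : E.Fib x s →ₗ[𝒜.Fib x] _) =
      E.toMatrix (LinearMap.id : E.Fib x s →ₗ[𝒜.Fib x] _) :=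
  (toMatrix_comp _ _).symm

variable [DecidableEq E.ι]

/-- If `p` and `q` are the idempotents of two fibres and `L` is a linear map between them with
matrix `a = p a q`, this is `a + (1 - p) (1 - q)`. -/
def completedMatrix (L : E.Fib x s →ₗ[𝒜.Fib x] E.Fib x t) : Matrix E.ι E.ι (𝒜.Fib x) :=
  E.toMatrix L + (1 - E.toMatrix (LinearMap.id : E.Fib x s →ₗ[𝒜.Fib x] _)) *
    (1 - E.toMatrix (LinearMap.id : E.Fib x t →ₗ[𝒜.Fib x] _))

/-- With `p = q = a` idempotent, `p + (1 - p)(1 - p) = p + (1 - p) = 1`. -/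
theorem completedMatrix_id :
    completedMatrix (LinearMap.id : E.Fib x s →ₗ[𝒜.Fib x] E.Fib x s) = 1 := by
  simp only [completedMatrix, mul_sub, sub_mul, mul_one, one_mul, toMatrix_id_mul_self]
  abel

theorem toMatrix_id_mul_completedMatrix (L : E.Fib x s →ₗ[𝒜.Fib x] E.Fib x t) :
    E.toMatrix (LinearMap.id : E.Fib x s →ₗ[𝒜.Fib x] _) * completedMatrix L = E.toMatrix L := by
  have h : E.toMatrix (LinearMap.id : E.Fib x s →ₗ[𝒜.Fib x] _) * E.toMatrix L = E.toMatrix L :=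
    (toMatrix_comp _ _).symm
  rw [completedMatrix, mul_add, ← mul_assoc, mul_one_sub (E.toMatrix (s := s) LinearMap.id),
    h, toMatrix_id_mul_self, sub_self,
    zero_mul, add_zero]

theorem completedMatrix_mul_toMatrix_id (L : E.Fib x s →ₗ[𝒜.Fib x] E.Fib x t) :
    completedMatrix L * E.toMatrix (LinearMap.id : E.Fib x t →ₗ[𝒜.Fib x] _) = E.toMatrix L := by
  have h : E.toMatrix L * E.toMatrix (LinearMap.id : E.Fib x t →ₗ[𝒜.Fib x] _) = E.toMatrix L :=
    (toMatrix_comp _ _).symm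
  rw [completedMatrix, add_mul, mul_assoc, one_sub_mul (E.toMatrix (t := t) LinearMap.id), h,
    toMatrix_id_mul_self, sub_self, mul_zero, add_zero]

/-- With `u` the completed matrix, `a = a q = p u` gives `a (q N p) = p u N p = p`, the matrix of
the identity. -/
theorem ofMatrix_comp {L : E.Fib x s →ₗ[𝒜.Fib x] E.Fib x t} {N : Matrix E.ι E.ι (𝒜.Fib x)}
    (h : completedMatrix L * N = 1) : E.ofMatrix t s N ∘ₗ L = LinearMap.id := by
  apply toMatrix_injective
  rw [toMatrix_comp, toMatrix_ofMatrix, ← mul_assoc, ← mul_assoc, ← toMatrix_comp,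
    LinearMap.id_comp, ← toMatrix_id_mul_completedMatrix, mul_assoc _ _ N, h, mul_one,
    toMatrix_id_mul_self]

/-- Symmetrically, `a = p a = u q` gives `(q N p) a = q N u q = q`. -/
theorem comp_ofMatrix {L : E.Fib x s →ₗ[𝒜.Fib x] E.Fib x t} {N : Matrix E.ι E.ι (𝒜.Fib x)}
    (h : N * completedMatrix L = 1) : L ∘ₗ E.ofMatrix t s N = LinearMap.id := by
  apply toMatrix_injective
  have h₀ : E.toMatrix (LinearMap.id : E.Fib x s →ₗ[𝒜.Fib x] _) * E.toMatrix L = E.toMatrix L :=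
    (toMatrix_comp _ _).symm
  rw [toMatrix_comp, toMatrix_ofMatrix, mul_assoc _ _ (E.toMatrix L), h₀,
    ← completedMatrix_mul_toMatrix_id L, mul_assoc _ N, ← mul_assoc N, h, one_mul,
    toMatrix_id_mul_self]

end Matrices

/-! ### The equivariant mean comparison map -/

section Equivariant

variable {T : Type*} [TopologicalSpace T] (E : FramedFamily 𝒜 T)
  [IsTopologicalGroup G] [ContinuousSMul G X]

theorem continuousAlong_conj {Z : Type*} [TopologicalSpace Z] {g : Z → G} {b : Z → X}
    {s t : Z → T} (hg : Continuous g) (hb : Continuous b) (hs : Continuous s) (ht : Continuous t)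
    {e : ∀ z, E.Fib (b z) (s z)} (he : E.ContinuousAlong b s e) :
    E.ContinuousAlong b t fun z => E.conj (g z) (b z) (s z) (t z) (e z) := by
  have hc : Continuous fun z => (g z)⁻¹ • b z := hg.inv.smul hb
  exact (ContinuousAlong.transport hc ht (he.act hb hs hg.inv hc fun z => rfl)).act hc ht hg hb
    fun z => smul_inv_smul (g z) (b z)

theorem continuousAlong_conj_const (x : X) (s t : T) (e : E.Fib x s) :
    E.ContinuousAlong (fun _ => x) (fun _ => t) fun g : G => E.conj g x s t e :=
  E.continuousAlong_conj continuous_id continuous_const continuous_const continuous_const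
    fun _ => continuous_const

variable [CompactSpace G] [MeasurableSpace G] [BorelSpace G] (μ : Measure G)
  [IsProbabilityMeasure μ] [CompleteSpace A]

/-- The average over `G` of the comparison maps: an equivariant comparison map. -/
def meanTransport (x : X) (s t : T) : E.Fib x s →ₗ[𝒜.Fib x] E.Fib x t where
  toFun e := avg μ fun g => E.conj g x s t e
  map_add' e e' := by
    simp only [conj_add]
    exact avg_add μ (E.continuousAlong_conj_const x s t e) (E.continuousAlong_conj_const x s t e')
  map_smul' a e := by
    simp only [conj_smul]
    exact avg_smul μ a (E.continuousAlong_conj_const x s t e)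

theorem meanTransport_apply (x : X) (s t : T) (e : E.Fib x s) :
    E.meanTransport μ x s t e = avg μ fun g => E.conj g x s t e := rfl

theorem meanTransport_self (x : X) (t : T) : E.meanTransport μ x t t = LinearMap.id := by
  ext e
  simp only [meanTransport_apply, conj_self, avg_const, LinearMap.id_apply]

/-- `conj_act` replaces `g` by `g₀⁻¹ * g`, left invariance removes the shift, and the action of `g₀`
passes through the mean. -/
theorem meanTransport_act [μ.IsMulLeftInvariant] (g₀ : G) {x x' : X} (h : g₀ • x = x') (s t : T)
    (e : E.Fib x s) :
    E.meanTransport μ x' s t (E.act g₀ h s e) = E.act g₀ h t (E.meanTransport μ x s t e) := by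
  simp only [meanTransport_apply, conj_act]
  rw [avg_mul_left μ (fun g => E.act g₀ h t (E.conj g x s t e)),
    act_avg μ g₀ h (E.continuousAlong_conj_const x s t e)]

variable {E} in
theorem ContinuousAlong.meanTransport {Z : Type*} [TopologicalSpace Z] {b : Z → X}
    {s t : Z → T} (hb : Continuous b) (hs : Continuous s) (ht : Continuous t)
    {e : ∀ z, E.Fib (b z) (s z)} (he : E.ContinuousAlong b s e) :
    E.ContinuousAlong b t fun z => E.meanTransport μ (b z) (s z) (t z) (e z) := by
  refine ContinuousAlong.avg μ hb (f := fun z g => E.conj g (b z) (s z) (t z) (e z)) ?_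
  exact E.continuousAlong_conj continuous_snd (hb.comp continuous_fst) (hs.comp continuous_fst)
    (ht.comp continuous_fst) (he.comp continuous_fst)

theorem continuous_completedMatrix [DecidableEq E.ι] {Z : Type*} [TopologicalSpace Z] {b : Z → X}
    {s t : Z → T} (hb : Continuous b) (hs : Continuous s) (ht : Continuous t) (k l : E.ι) :
    Continuous fun z =>
      (⟨b z, completedMatrix (E.meanTransport μ (b z) (s z) (t z)) k l⟩ : Tot 𝒜.Fib) := by
  have h1 (i j : E.ι) : Continuous fun z => (⟨b z, (1 : Matrix E.ι E.ι (𝒜.Fib (b z))) i j⟩ :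
      Tot 𝒜.Fib) := by
    by_cases h : i = j
    · subst h
      simpa using GAlgBundle.continuous_one hb
    · simpa [Matrix.one_apply_ne h] using GAlgBundle.continuous_zero hb
  simp only [completedMatrix, Matrix.add_apply, Matrix.mul_apply, Matrix.sub_apply]
  refine GAlgBundle.continuous_add ?_ (GAlgBundle.continuous_sum hb _ fun i =>
    GAlgBundle.continuous_mul (GAlgBundle.continuous_sub (h1 k i) ?_)
      (GAlgBundle.continuous_sub (h1 i l) ?_))
  · exact ContinuousAlong.meanTransport μ hb hs ht (continuousAlong_sec hb hs k) l
  · exact continuousAlong_sec hb hs k i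
  · exact continuousAlong_sec hb ht i l

end Equivariant

/-! ### Isomorphisms between reparametrized families -/

section Isomorphisms

variable {T : Type*} [TopologicalSpace T]

/-- An equivariant isomorphism between two reparametrizations of a framed family. -/
structure Iso (E : FramedFamily 𝒜 T) {S : Type*} [TopologicalSpace S] (a b : S → T) where
  toEquiv : ∀ x s, E.Fib x (a s) ≃ₗ[𝒜.Fib x] E.Fib x (b s)
  continuous_toEquiv : ∀ k, E.ContinuousAlong (fun q : X × S => q.1) (fun q => b q.2)
    fun q => toEquiv q.1 q.2 (E.sec k q.1 (a q.2))
  continuous_symm : ∀ k, E.ContinuousAlong (fun q : X × S => q.1) (fun q => a q.2)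
    fun q => (toEquiv q.1 q.2).symm (E.sec k q.1 (b q.2))
  map_act : ∀ (g : G) {x x' : X} (h : g • x = x') (s : S) (e : E.Fib x (a s)),
    toEquiv x' s (E.act g h (a s) e) = E.act g h (b s) (toEquiv x s e)

variable {E : FramedFamily 𝒜 T} {S : Type*} [TopologicalSpace S] {a b c : S → T}

/-- The identity isomorphism. -/
def Iso.refl (ha : Continuous a) : E.Iso a a where
  toEquiv _ _ := LinearEquiv.refl _ _
  continuous_toEquiv k := continuousAlong_sec continuous_fst (ha.comp continuous_snd) k
  continuous_symm k := continuousAlong_sec continuous_fst (ha.comp continuous_snd) k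
  map_act _ _ _ _ _ _ := rfl

/-- Composition of isomorphisms. -/
def Iso.trans (f : E.Iso a b) (f' : E.Iso b c) : E.Iso a c where
  toEquiv x s := (f.toEquiv x s).trans (f'.toEquiv x s)
  continuous_toEquiv k := (f.continuous_toEquiv k).linearMap continuous_fst
    (L := fun q : X × S => (f'.toEquiv q.1 q.2).toLinearMap) f'.continuous_toEquiv
  continuous_symm k := (f'.continuous_symm k).linearMap continuous_fst
    (L := fun q : X × S => (f.toEquiv q.1 q.2).symm.toLinearMap) f.continuous_symm
  map_act g _ _ h s e := by
    simp only [LinearEquiv.trans_apply, f.map_act, f'.map_act]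

variable [IsTopologicalGroup G] [CompactSpace G] [MeasurableSpace G] [BorelSpace G] (μ : Measure G)
  [IsProbabilityMeasure μ] [μ.IsMulLeftInvariant] [ContinuousSMul G X] [CompleteSpace A]

/-- The mean comparison map is the isomorphism. Its inverse has matrix `q N p`, where `N` inverts
the completed matrix, and `N` has continuous entries. -/
theorem nonempty_iso_of_isUnit [DecidableEq E.ι] (ha : Continuous a) (hb : Continuous b)
    (h : ∀ x s, IsUnit (completedMatrix (E.meanTransport μ x (a s) (b s)))) :
    Nonempty (E.Iso a b) := by
  let N (x : X) (s : S) : Matrix E.ι E.ι (𝒜.Fib x) := ((h x s).unit⁻¹ : (Matrix _ _ _)ˣ)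
  have h₁ (x s) : completedMatrix (E.meanTransport μ x (a s) (b s)) * N x s = 1 :=
    (h x s).mul_val_inv
  have h₂ (x s) : N x s * completedMatrix (E.meanTransport μ x (a s) (b s)) = 1 :=
    (h x s).val_inv_mul
  have ha' : Continuous fun q : X × S => a q.2 := ha.comp continuous_snd
  have hb' : Continuous fun q : X × S => b q.2 := hb.comp continuous_snd
  have hN (i j) : Continuous fun q : X × S => (⟨q.1, N q.1 q.2 i j⟩ : Tot 𝒜.Fib) :=
    GAlgBundle.continuous_inverse_matrix (b := fun q : X × S => q.1) continuous_fst
      (E.continuous_completedMatrix μ continuous_fst ha' hb') (fun q => h₁ q.1 q.2)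
      (fun q => h₂ q.1 q.2) i j
  refine ⟨{
    toEquiv := fun x s => LinearEquiv.ofLinearMap (E.meanTransport μ x (a s) (b s))
      (E.ofMatrix (b s) (a s) (N x s)) (comp_ofMatrix (h₂ x s)) (ofMatrix_comp (h₁ x s))
    continuous_toEquiv := fun k => ContinuousAlong.meanTransport μ continuous_fst ha' hb'
      (continuousAlong_sec continuous_fst ha' k)
    continuous_symm := fun k l => ?_
    map_act := fun g _ _ hx s e => E.meanTransport_act μ g hx (a s) (b s) e }⟩
  refine (GAlgBundle.continuous_sum continuous_fst Finset.univ fun j => GAlgBundle.continuous_mul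
    (GAlgBundle.continuous_sum continuous_fst Finset.univ fun i => GAlgBundle.continuous_mul
      (continuousAlong_sec (E := E) continuous_fst hb' k i) (hN i j))
    (continuousAlong_sec continuous_fst ha' j l)).congr fun q => ?_
  have := congrFun (congrFun (toMatrix_ofMatrix (s := b q.2) (t := a q.2) (N q.1 q.2)) k) l
  simp only [Matrix.mul_apply, toMatrix, Matrix.of_apply, LinearMap.id_apply] at this
  exact congrArg (fun y => (⟨q.1, y⟩ : Tot 𝒜.Fib)) this.symm

end Isomorphisms

/-! ### Joining level zero to every level by short steps -/

section Chain

variable [IsTopologicalGroup G] [CompactSpace G] [MeasurableSpace G] [BorelSpace G]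
  [ContinuousSMul G X] [CompleteSpace A] [CompactSpace X]

theorem eventually_isUnit (μ : Measure G) [IsProbabilityMeasure μ] {T : Type*} [UniformSpace T]
    [CompactSpace T] (E : FramedFamily 𝒜 T) [DecidableEq E.ι] : ∀ᶠ p in uniformity T,
      ∀ x, IsUnit (completedMatrix (E.meanTransport μ x p.1 p.2)) := by
  have ho : IsOpen {q : X × (T × T) | IsUnit (completedMatrix
      (E.meanTransport μ q.1 q.2.1 q.2.2))} :=
    GAlgBundle.isOpen_isUnit_matrix continuous_fst
      (E.continuous_completedMatrix μ continuous_fst (by fun_prop) (by fun_prop))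
  have ho' : IsOpen {p : T × T | ∀ x, IsUnit (completedMatrix
      (E.meanTransport μ x p.1 p.2))} := by
    -- Tube lemma: as `X` is compact, the pairs that fail for some `x` form a closed set.
    have := (isClosedMap_snd_of_compactSpace _ ho.isClosed_compl).isOpen_compl
    convert this using 1
    ext p
    simp
  -- In a compact `T` the entourages are the neighbourhoods of the diagonal, where the completed
  -- matrix is `1`.
  rw [← nhdsSet_diagonal_eq_uniformity]
  refine ho'.mem_nhdsSet.2 ?_
  rintro ⟨t, t'⟩ (rfl : t = t') x
  rw [meanTransport_self, completedMatrix_id]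
  exact isUnit_one

theorem nonempty_iso_zero (μ : Measure G) [IsProbabilityMeasure μ] [μ.IsMulLeftInvariant]
    (E : FramedFamily 𝒜 unitInterval) :
    Nonempty (E.Iso (fun _ => 0) id) := by
  classical
  obtain ⟨δ, hδ, h⟩ := Metric.mem_uniformity_dist.1 (E.eventually_isUnit μ)
  obtain ⟨n, hn⟩ := exists_nat_one_div_lt hδ
  -- The path from `0` to `s` in `n + 1` equal steps, continuous in `s`. Since `projIcc` is
  -- `1`-Lipschitz, the step bound `1 / (n + 1)` holds for every natural `i`.
  let c : ℕ → unitInterval → unitInterval := fun i s =>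
    Set.projIcc (0 : ℝ) 1 zero_le_one (i / (n + 1)) * s
  have hc (i) : Continuous (c i) := continuous_const.mul continuous_id
  have hstep (i) : Nonempty (E.Iso (c i) (c (i + 1))) := by
    refine nonempty_iso_of_isUnit μ (hc i) (hc (i + 1)) fun x s => h ?_ x
    refine lt_of_le_of_lt ?_ hn
    rw [Subtype.dist_eq, Real.dist_eq]
    simp only [Set.Icc.coe_mul, ← sub_mul, abs_mul]
    have h₁ : |((Set.projIcc (0 : ℝ) 1 zero_le_one (i / (n + 1)) : unitInterval) : ℝ) -
        (Set.projIcc (0 : ℝ) 1 zero_le_one ((i + 1 : ℕ) / (n + 1)) : unitInterval)| ≤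
        1 / (n + 1) := by
      refine (LipschitzWith.projIcc (h := zero_le_one).dist_le_mul _ _).trans ?_
      rw [Real.dist_eq, ← sub_div]
      push_cast
      rw [one_mul, sub_add_cancel_left, abs_div, abs_neg, abs_one,
        abs_of_pos (by positivity)]
    have h₂ : |(s : ℝ)| ≤ 1 := abs_le.2 ⟨by linarith [s.2.1], s.2.2⟩
    calc _ ≤ 1 / ((n : ℝ) + 1) * 1 := mul_le_mul h₁ h₂ (abs_nonneg _) (by positivity)
      _ = _ := mul_one _
  have hall (i) : Nonempty (E.Iso (c 0) (c i)) := by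
    induction i with
    | zero => exact ⟨Iso.refl (hc 0)⟩
    | succ i ih => exact ⟨ih.some.trans (hstep i).some⟩
  have h0 : c 0 = fun _ => 0 := by
    funext s
    simp [c]
  have h1 : c (n + 1) = id := by
    funext s
    have : ((n + 1 : ℕ) : ℝ) / (n + 1) = 1 := by
      push_cast
      exact div_self (by positivity)
    simp only [c, this, Set.projIcc_right]
    exact one_mul s
  rw [← h0, ← h1]
  exact hall (n + 1)

end Chain

end FramedFamily

/-! ### Isomorphic bundles have equal classes -/

section ZeroBundle

variable {G : Type w} {X : Type u} {A : Type v} [Group G] [TopologicalSpace G]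
  [TopologicalSpace X] [MulAction G X] [NormedRing A] [NormedAlgebra ℝ A]

theorem KGroup.mk_eq_add {𝒜 : GAlgBundle G X A} {E E₁ E₂ : GABundle 𝒜} (h : E.IsDirectSum E₁ E₂) :
    KGroup.mk E = KGroup.mk E₁ + KGroup.mk E₂ := by
  refine (QuotientAddGroup.eq_iff_sub_mem (N := KRelations 𝒜)
    (x := FreeAbelianGroup.of E)
    (y := FreeAbelianGroup.of E₁ + FreeAbelianGroup.of E₂)).2 ?_
  exact AddSubgroup.subset_closure ⟨E, E₁, E₂, h, rfl⟩

theorem KGroup.hom_ext {𝒜 : GAlgBundle G X A} {B : Type*} [AddCommGroup B] {f g : KGroup 𝒜 →+ B}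
    (h : ∀ E, f (KGroup.mk E) = g (KGroup.mk E)) : f = g := by
  apply QuotientAddGroup.addMonoidHom_ext
  exact FreeAbelianGroup.lift_ext _ _ h

variable [ContinuousSMul G X]

/-- The zero bundle. -/
def GABundle.zero (𝒜 : GAlgBundle G X A) : GABundle 𝒜 where
  Fib _ := PUnit.{v + 1}
  top := TopologicalSpace.induced TotalSpace.proj inferInstance
  continuous_proj := continuous_induced_dom
  continuous_smul := by
    let _ : TopologicalSpace (Tot fun _ : X => PUnit.{v + 1}) :=
      TopologicalSpace.induced TotalSpace.proj inferInstance
    refine continuous_induced_rng.2 ?_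
    exact continuous_induced_dom.comp (continuous_snd.comp continuous_subtype_val)
  exists_chart x := by
    let _ : TopologicalSpace (Tot fun _ : X => PUnit.{v + 1}) :=
      TopologicalSpace.induced TotalSpace.proj inferInstance
    obtain ⟨U, hU, hx, φ, hφ⟩ := 𝒜.exists_chart x
    let _ : TopologicalSpace PUnit.{v + 1} := moduleTopology A PUnit.{v + 1}
    exact ⟨U, hU, hx, φ, hφ, PUnit.{v + 1}, inferInstance, inferInstance, inferInstance,
      inferInstance, inferInstance, ⟨rfl⟩, fun _ => AddEquiv.refl _,
      ⟨continuous_of_const fun _ _ => rfl,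
        continuous_induced_rng.2 (continuous_subtype_val.comp continuous_fst)⟩, fun _ _ _ => rfl⟩
  act _ _ _ _ := 0
  act_one _ _ := rfl
  act_mul _ _ _ _ _ _ _ _ _ := rfl
  continuous_act := by
    let _ : TopologicalSpace (Tot fun _ : X => PUnit.{v + 1}) :=
      TopologicalSpace.induced TotalSpace.proj inferInstance
    refine continuous_induced_rng.2 ?_
    exact continuous_fst.smul (continuous_induced_dom.comp continuous_snd)
  act_smul _ _ _ _ _ _ := rfl

variable {𝒜 : GAlgBundle G X A}

/-- The zero morphism into the zero bundle. -/
def GABundle.Hom.toZero (E : GABundle 𝒜) : E.Hom (GABundle.zero 𝒜) where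
  map _ := (0 : _ →ₗ[_] PUnit.{v + 1})
  continuous_map := continuous_induced_rng.2 E.continuous_proj
  map_act _ _ _ _ _ := rfl

/-- The zero morphism from the zero bundle. -/
def GABundle.Hom.fromZero (E : GABundle 𝒜) : (GABundle.zero 𝒜).Hom E where
  map _ := (0 : PUnit.{v + 1} →ₗ[_] _)
  continuous_map := GABundle.continuous_zero (GABundle.zero 𝒜).continuous_proj
  map_act g _ _ h _ := (map_zero (E.act g h)).symm

theorem GABundle.isDirectSum_zero {E F : GABundle 𝒜} (f : E.Hom F) (f' : F.Hom E)
    (h : ∀ x, f'.map x ∘ₗ f.map x = LinearMap.id) (h' : ∀ x, f.map x ∘ₗ f'.map x = LinearMap.id) :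
    E.IsDirectSum F (GABundle.zero 𝒜) := by
  refine ⟨f', Hom.fromZero E, f, Hom.toZero E, fun x => ⟨h' x, rfl, ?_, rfl, ?_⟩⟩
  · exact LinearMap.comp_zero _
  · rw [h]
    exact (congrArg _ (LinearMap.zero_comp _)).trans (add_zero _)

/-- The identity morphism. -/
def GABundle.Hom.id (E : GABundle 𝒜) : E.Hom E where
  map _ := LinearMap.id
  continuous_map := continuous_id
  map_act _ _ _ _ _ := rfl

/-- The zero bundle is the direct sum of two copies of itself, so its class equals its double. -/
theorem KGroup.mk_zero : KGroup.mk (GABundle.zero 𝒜) = 0 := by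
  have h := KGroup.mk_eq_add (GABundle.isDirectSum_zero (GABundle.Hom.id (GABundle.zero 𝒜))
    (GABundle.Hom.id _) (fun _ => rfl) fun _ => rfl)
  simpa using h

/-- The relations mention only direct sums; an isomorphism enters as a decomposition of `E` into `F`
and the zero bundle. -/
theorem KGroup.mk_eq_mk {E F : GABundle 𝒜} (f : E.Hom F) (f' : F.Hom E)
    (h : ∀ x, f'.map x ∘ₗ f.map x = LinearMap.id) (h' : ∀ x, f.map x ∘ₗ f'.map x = LinearMap.id) :
    KGroup.mk E = KGroup.mk F := by
  rw [KGroup.mk_eq_add (GABundle.isDirectSum_zero f f' h h'), KGroup.mk_zero, add_zero]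

end ZeroBundle

/-! ### Restriction to a level and pullback to the cylinder -/

section Cylinder

variable {G : Type w} {X : Type u} {A : Type v} [Group G] [TopologicalSpace G]
  [TopologicalSpace X] [MulAction G X] [ContinuousSMul G X] [NormedRing A] [NormedAlgebra ℝ A]

/-- The pullback of an algebra bundle to the cylinder. -/
abbrev GAlgBundle.cylinder (𝒜 : GAlgBundle G X A) : GAlgBundle G (X × unitInterval) A :=
  𝒜.pullback (cylinderProj G X) (continuous_cylinderProj G X)

variable {𝒜 : GAlgBundle G X A}

theorem GAlgBundle.continuous_cylinder {Z : Type*} [TopologicalSpace Z] {b : Z → X}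
    {t : Z → unitInterval} (ht : Continuous t) {f : ∀ z, 𝒜.Fib (b z)}
    (hf : Continuous fun z => (⟨b z, f z⟩ : Tot 𝒜.Fib)) :
    Continuous fun z => (⟨(b z, t z), f z⟩ : Tot 𝒜.cylinder.Fib) :=
  continuous_into_pullback (cylinderProj G X) 𝒜.Fib ((continuous_base hf).prodMk ht) hf

theorem GAlgBundle.continuous_of_cylinder {Z : Type*} [TopologicalSpace Z]
    {b : Z → X × unitInterval} {f : ∀ z, 𝒜.cylinder.Fib (b z)}
    (hf : Continuous fun z => (⟨b z, f z⟩ : Tot 𝒜.cylinder.Fib)) :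
    Continuous fun z => (⟨(b z).1, f z⟩ : Tot 𝒜.Fib) :=
  let _ := pullbackTop (cylinderProj G X) 𝒜.Fib
  (continuous_pullback_lift (cylinderProj G X) 𝒜.Fib).comp hf

/-- The restriction of a bundle on the cylinder to a level. -/
def GABundle.restrict (E : GABundle 𝒜.cylinder) (t : unitInterval) : GABundle 𝒜 where
  Fib x := E.Fib (x, t)
  addCommGroup x := E.addCommGroup (x, t)
  module x := E.module (x, t)
  top := pullbackTop (fun x => (x, t)) E.Fib
  continuous_proj := continuous_pullback_proj (fun x => (x, t)) E.Fib
  continuous_smul := by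
    let _ := pullbackTop (fun x : X => (x, t)) E.Fib
    let S := {p : Tot 𝒜.Fib × Tot (fun x => E.Fib (x, t)) // p.1.proj = p.2.proj}
    have h₁ : Continuous fun p : S => (⟨p.1.1.proj, p.1.1.snd⟩ : Tot 𝒜.Fib) :=
      continuous_fst.comp continuous_subtype_val
    have h₂ : Continuous fun p : S => p.1.2 := continuous_snd.comp continuous_subtype_val
    have h₃ : Continuous fun p : S => p.1.2.proj :=
      (continuous_pullback_proj (fun x => (x, t)) E.Fib).comp h₂
    refine continuous_into_pullback (fun x => (x, t)) E.Fib h₃ ?_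
    refine (E.continuous_smul.comp (Continuous.subtype_mk
      ((GAlgBundle.continuous_cylinder (t := fun _ => t) continuous_const h₁).prodMk
        ((continuous_pullback_lift (fun x => (x, t)) E.Fib).comp h₂))
      (fun p => congrArg (fun x => (x, t)) p.2))).congr ?_
    rintro ⟨⟨⟨y, a⟩, ⟨y', e⟩⟩, h⟩
    obtain rfl : y = y' := h
    rfl
  exists_chart x := by
    obtain ⟨U, hU, hy, φ, hφ, P, i₁, i₂, i₃, h₁, h₂, h₃, ψ, hψ, hs⟩ := E.exists_chart (x, t)
    have hc : Continuous fun x : X => (x, t) := by fun_prop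
    refine ⟨(fun x => (x, t)) ⁻¹' U, hU.preimage hc, hy, fun y => φ ⟨(y.1, t), y.2⟩, ?_, P, i₁, i₂,
      i₃, h₁, h₂, h₃, fun y => ψ ⟨(y.1, t), y.2⟩, hψ.pullback hc,
      fun y a e => hs ⟨(y.1, t), y.2⟩ a e⟩
    refine ⟨?_, ?_⟩
    · have h := GAlgBundle.continuous_cylinder (t := fun _ => t) continuous_const
        (continuous_subtype_val (p := fun p : Tot 𝒜.Fib => (p.proj, t) ∈ U))
      exact hφ.1.comp (h.subtype_mk fun p => p.2)
    · have h : Continuous fun q : ((fun x => (x, t)) ⁻¹' U) × A =>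
          ((⟨(q.1.1, t), q.1.2⟩ : U), q.2) := by fun_prop
      exact GAlgBundle.continuous_of_cylinder (hφ.2.comp h)
  act g _ _ h := E.act g (Prod.ext h rfl)
  act_one _ e := E.act_one _ e
  act_mul g₁ g₂ _ _ _ _ _ _ e := E.act_mul g₁ g₂ _ _ _ e
  continuous_act := by
    let _ := pullbackTop (fun x : X => (x, t)) E.Fib
    refine continuous_into_pullback (fun x => (x, t)) E.Fib ?_ ?_
    · exact continuous_fst.smul
        ((continuous_pullback_proj (fun x => (x, t)) E.Fib).comp continuous_snd)
    · exact E.continuous_act.comp (continuous_fst.prodMk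
        ((continuous_pullback_lift (fun x => (x, t)) E.Fib).comp continuous_snd))
  act_smul g x x' h a e := E.act_smul g (x := (x, t)) (x' := (x', t)) (Prod.ext h rfl) a e

/-- The restriction of a morphism to a level. -/
def GABundle.Hom.restrict {E F : GABundle 𝒜.cylinder} (φ : E.Hom F) (t : unitInterval) :
    (E.restrict t).Hom (F.restrict t) where
  map x := φ.map (x, t)
  continuous_map :=
    let _ := pullbackTop (fun x : X => (x, t)) E.Fib
    continuous_into_pullback (fun x => (x, t)) F.Fib
      (continuous_pullback_proj (fun x => (x, t)) E.Fib)
      (φ.continuous_map.comp (continuous_pullback_lift (fun x => (x, t)) E.Fib))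
  map_act g _ _ _ e := φ.map_act g _ e

theorem GABundle.IsDirectSum.restrict {E E₁ E₂ : GABundle 𝒜.cylinder} (h : E.IsDirectSum E₁ E₂)
    (t : unitInterval) : (E.restrict t).IsDirectSum (E₁.restrict t) (E₂.restrict t) := by
  obtain ⟨i₁, i₂, p₁, p₂, h⟩ := h
  exact ⟨i₁.restrict t, i₂.restrict t, p₁.restrict t, p₂.restrict t, fun x => h (x, t)⟩

/-- The homomorphism induced on Grothendieck groups by restriction to a level. -/
def KGroup.restrict (𝒜 : GAlgBundle G X A) (t : unitInterval) : KGroup 𝒜.cylinder →+ KGroup 𝒜 :=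
  QuotientAddGroup.map _ _ (FreeAbelianGroup.map fun E => E.restrict t) <| by
    refine (AddSubgroup.closure_le _).2 ?_
    rintro _ ⟨E, E₁, E₂, h, rfl⟩
    refine AddSubgroup.subset_closure
      ⟨E.restrict t, E₁.restrict t, E₂.restrict t, h.restrict t, ?_⟩
    simp

/-- The pullback of a bundle to the cylinder. -/
abbrev GABundle.cylinder (E : GABundle 𝒜) : GABundle 𝒜.cylinder :=
  E.pullback (cylinderProj G X) (continuous_cylinderProj G X)

theorem GABundle.continuous_lift_restrict (E : GABundle 𝒜.cylinder) (t : unitInterval) :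
    Continuous fun z : Tot (E.restrict t).Fib => (⟨(z.proj, t), z.snd⟩ : Tot E.Fib) :=
  continuous_pullback_lift (fun x => (x, t)) E.Fib

theorem GABundle.continuous_lift_cylinder (E : GABundle 𝒜) :
    Continuous fun z : Tot E.cylinder.Fib => (⟨z.proj.1, z.snd⟩ : Tot E.Fib) :=
  continuous_pullback_lift (cylinderProj G X) E.Fib

/-- The fibres coincide, so the identity maps serve; only the continuity for the twice induced
topology needs an argument. -/
theorem KGroup.mk_restrict_cylinder (E : GABundle 𝒜) (t : unitInterval) :
    KGroup.mk (E.cylinder.restrict t) = KGroup.mk E := by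
  let f : (E.cylinder.restrict t).Hom E :=
    { map := fun x => (LinearMap.id : E.Fib x →ₗ[𝒜.Fib x] E.Fib x)
      continuous_map := (E.continuous_lift_cylinder).comp (E.cylinder.continuous_lift_restrict t)
      map_act := fun _ _ _ _ _ => rfl }
  let f' : E.Hom (E.cylinder.restrict t) :=
    { map := fun x => (LinearMap.id : E.Fib x →ₗ[𝒜.Fib x] E.Fib x)
      continuous_map := by
        refine continuous_into_pullback (fun x => (x, t)) E.cylinder.Fib E.continuous_proj ?_
        exact continuous_into_pullback (cylinderProj G X) E.Fib
          (E.continuous_proj.prodMk continuous_const) continuous_id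
      map_act := fun _ _ _ _ _ => rfl }
  exact KGroup.mk_eq_mk f f' (fun _ => rfl) fun _ => rfl

/-- The framed family defined by a bundle on the cylinder. -/
def GABundle.Frame.family {E : GABundle 𝒜.cylinder} (F : E.Frame) :
    FramedFamily 𝒜 unitInterval where
  Fib x t := E.Fib (x, t)
  addCommGroup x t := E.addCommGroup (x, t)
  module x t := E.module (x, t)
  act g _ _ h _ := E.act g (Prod.ext h rfl)
  act_one _ _ e := E.act_one _ e
  act_mul g₁ g₂ _ _ _ _ _ _ _ e := E.act_mul g₁ g₂ _ _ _ e
  act_smul g x x' h t a e := E.act_smul g (x := (x, t)) (x' := (x', t)) (Prod.ext h rfl) a e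
  ι := F.ι
  sec k x t := F.sec k (x, t)
  coord k x t := F.coord k (x, t)
  sum_coord_smul_sec x t e := F.sum_coord_smul_sec (x, t) e
  continuous_coord_act k l := GAlgBundle.continuous_of_cylinder <| (F.continuous_coord l).comp <|
    E.continuous_act.comp (continuous_fst.prodMk ((F.continuous_sec k).comp continuous_snd))

variable {E : GABundle 𝒜.cylinder} (F : E.Frame)

theorem GABundle.Frame.continuousAlong {Z : Type*} [TopologicalSpace Z] {b : Z → X}
    {t : Z → unitInterval} {e : ∀ z, E.Fib (b z, t z)}
    (he : Continuous fun z => (⟨(b z, t z), e z⟩ : Tot E.Fib)) :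
    F.family.ContinuousAlong b t e :=
  fun k => GAlgBundle.continuous_of_cylinder ((F.continuous_coord k).comp he)

/-- Since `e = ∑ coord k e • sec k`, the coordinates recover the topology of `E`. Hence isomorphisms
of the framed family become morphisms of bundles. -/
theorem GABundle.Frame.continuous_of_continuousAlong {Z : Type*} [TopologicalSpace Z] {b : Z → X}
    {t : Z → unitInterval} (hb : Continuous b) (ht : Continuous t) {e : ∀ z, E.Fib (b z, t z)}
    (he : F.family.ContinuousAlong b t e) :
    Continuous fun z => (⟨(b z, t z), e z⟩ : Tot E.Fib) := by
  refine (GABundle.continuous_sum (E := E) (hb.prodMk ht) Finset.univ fun k =>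
    GABundle.continuous_smul_apply (E := E) (GAlgBundle.continuous_cylinder ht (he k))
      ((F.continuous_sec k).comp (hb.prodMk ht))).congr fun z => ?_
  exact congrArg (fun e => (⟨(b z, t z), e⟩ : Tot E.Fib)) (F.sum_coord_smul_sec (b z, t z) (e z))

/-- A trivialization of the family in the direction of the interval gives a morphism from the
pullback of a level. -/
def GABundle.Frame.homOfIso (J : F.family.Iso (fun _ => 0) id) : (E.restrict 0).cylinder.Hom E where
  map p := (J.toEquiv p.1 p.2).toLinearMap
  continuous_map := by
    let C := (E.restrict 0).cylinder
    have hp : Continuous fun z : Tot C.Fib => z.proj := C.continuous_proj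
    have hb : Continuous fun z : Tot C.Fib => z.proj.1 := continuous_fst.comp hp
    have h₁ : F.family.ContinuousAlong (fun z : Tot C.Fib => z.proj.1) (fun _ => 0)
        fun z => z.snd := F.continuousAlong
      ((E.continuous_lift_restrict 0).comp (E.restrict 0).continuous_lift_cylinder)
    have h₂ := h₁.linearMap hb (t := fun z : Tot C.Fib => z.proj.2)
      (L := fun z : Tot C.Fib => (J.toEquiv z.proj.1 z.proj.2).toLinearMap)
      fun k => (J.continuous_toEquiv k).comp hp
    exact F.continuous_of_continuousAlong (continuous_fst.comp hp) (continuous_snd.comp hp) h₂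
  map_act g p p' h e := by
    subst h
    exact J.map_act g rfl p.2 e

/-- The inverse of `GABundle.Frame.homOfIso`. -/
def GABundle.Frame.invHomOfIso (J : F.family.Iso (fun _ => 0) id) :
    E.Hom (E.restrict 0).cylinder where
  map p := (J.toEquiv p.1 p.2).symm.toLinearMap
  continuous_map := by
    have hp : Continuous fun z : Tot E.Fib => z.proj := E.continuous_proj
    have hb : Continuous fun z : Tot E.Fib => z.proj.1 := continuous_fst.comp hp
    have h₁ : F.family.ContinuousAlong (fun z : Tot E.Fib => z.proj.1) (fun z => z.proj.2)
        fun z => z.snd := F.continuousAlong continuous_id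
    have h₂ := h₁.linearMap hb (t := fun _ : Tot E.Fib => 0)
      (L := fun z : Tot E.Fib => (J.toEquiv z.proj.1 z.proj.2).symm.toLinearMap)
      fun k => (J.continuous_symm k).comp hp
    have h₃ := F.continuous_of_continuousAlong (continuous_fst.comp hp) continuous_const h₂
    refine continuous_into_pullback (cylinderProj G X) (E.restrict 0).Fib hp ?_
    exact continuous_into_pullback (fun x => (x, 0)) E.Fib (continuous_fst.comp hp) h₃
  map_act g p p' h e := by
    subst h
    -- The inverse of an equivariant bijection is equivariant: compare the two sides after applying
    -- the bijection.
    apply (J.toEquiv (g • p).1 (g • p).2).injective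
    refine ((J.toEquiv (g • p).1 (g • p).2).apply_symm_apply _).trans ?_
    refine Eq.trans ?_ (J.map_act g rfl p.2 ((J.toEquiv p.1 p.2).symm e)).symm
    exact congrArg (E.act g rfl) ((J.toEquiv p.1 p.2).apply_symm_apply e).symm

theorem KGroup.mk_cylinder_restrict [CompleteSpace A] [IsTopologicalGroup G] [CompactSpace G]
    [CompactSpace X] [T2Space X] (E : GABundle 𝒜.cylinder) :
    KGroup.mk (E.restrict 0).cylinder = KGroup.mk E := by
  let _ : MeasurableSpace G := borel G
  have : BorelSpace G := ⟨rfl⟩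
  -- Haar measure normalized on the whole compact group has total mass `1`.
  let μ : Measure G := Measure.haarMeasure ⊤
  have : IsProbabilityMeasure μ := ⟨by
    simpa [μ] using Measure.haarMeasure_self (K₀ := (⊤ : TopologicalSpace.PositiveCompacts G))⟩
  obtain ⟨F⟩ := E.exists_frame
  obtain ⟨J⟩ := F.family.nonempty_iso_zero μ
  refine KGroup.mk_eq_mk (F.homOfIso J) (F.invHomOfIso J) (fun p => ?_) fun p => ?_
  · ext e
    exact (J.toEquiv p.1 p.2).symm_apply_apply e
  · ext e
    exact (J.toEquiv p.1 p.2).apply_symm_apply e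

end Cylinder

end TwistedK

end

theorem mainTheorem9
    {A : Type v} [NormedRing A] [NormedAlgebra ℝ A] [CompleteSpace A]
    {n : ℕ} {G : Type w} [Group G] [TopologicalSpace G] [T2Space G] [CompactSpace G]
    [ChartedSpace (EuclideanSpace ℝ (Fin n)) G]
    [LieGroup (modelWithCornersSelf ℝ (EuclideanSpace ℝ (Fin n))) ((⊤ : ℕ∞) : WithTop ℕ∞) G]
    {X : Type u} [TopologicalSpace X] [T2Space X] [CompactSpace X]
    [MulAction G X] [ContinuousSMul G X]
    (𝒜 : TwistedK.GAlgBundle G X A) :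
    Function.Bijective
      (TwistedK.KGroup.pullback 𝒜 (TwistedK.cylinderProj G X)
        (TwistedK.continuous_cylinderProj G X)) := by
  -- Haar measure and the continuity of conjugation use only the underlying topological group.
  have : IsTopologicalGroup G := topologicalGroup_of_lieGroup
    (modelWithCornersSelf ℝ (EuclideanSpace ℝ (Fin n))) ((⊤ : ℕ∞) : WithTop ℕ∞)
  have h₁ : (TwistedK.KGroup.restrict 𝒜 0).comp (TwistedK.KGroup.pullback 𝒜
      (TwistedK.cylinderProj G X) (TwistedK.continuous_cylinderProj G X)) = AddMonoidHom.id _ :=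
    TwistedK.KGroup.hom_ext fun E => TwistedK.KGroup.mk_restrict_cylinder E 0
  have h₂ : (TwistedK.KGroup.pullback 𝒜 (TwistedK.cylinderProj G X)
      (TwistedK.continuous_cylinderProj G X)).comp (TwistedK.KGroup.restrict 𝒜 0) =
      AddMonoidHom.id _ :=
    TwistedK.KGroup.hom_ext fun E => TwistedK.KGroup.mk_cylinder_restrict E
  exact ⟨Function.LeftInverse.injective (DFunLike.congr_fun h₁),
    Function.RightInverse.surjective (DFunLike.congr_fun h₂)⟩
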